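/- Setting. Let $d\ge 1$, and let $\Lambda=\prod_{k=1}^d \mathbb Z/L_k\mathbb Z$ be a finite $d$-dimensional square lattice with periodic boundary conditions, with nearest-neighbour edges, graph distance $\mathsf d$ and $\mathrm{diam}\,S=\max_{i,j\in S}\mathsf d(i,j)$. A qudit $\mathbb C^q$ with basis $|0\rangle,\dots,|q-1\rangle$ sits on every site, and $|\mathbf 0\rangle$ is the all-zero product state. A Hamiltonian comes with a decomposition $H=\sum_S H_S$ into Hermitian terms $H_S$ supported in connected nonempty sets $S\subseteq\Lambda$. It is translation-invariant if, for all $S$ and every translation of $\Lambda$, the term on the translate of $S$ is the translate of $H_S$. For $\kappa>0$ and $\alpha\in(0,1)$ put $\|H\|_\kappa=\max_{i\in\Lambda}\sum_{S\ni i}e^{\kappa(\mathrm{diam}\,S)^\alpha}\|H_S\|$, with the operator norm on the right. For a nonzero vector $\psi$ put $H[\psi]=\langle\psi|H|\psi\rangle/\langle\psi|\psi\rangle$, and put $H[0]=+\infty$. The pair $(H,\psi)$ is $(\Delta,R)$-metastable if $R\ge 1$ and $$H\big[(\mathcal O-\langle\mathcal O\rangle_\psi)\psi\big]-H[\psi]\ge\Delta,\qquad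 \langle\mathcal O\rangle_\psi=\frac{\langle\psi|\mathcal O|\psi\rangle}{\langle\psi|\psi\rangle},$$ for every Hermitian operator $\mathcal O$ supported in a connected set $S$ with $\mathrm{diam}\,S\le R$. Theorem. For all $d\ge1$, $\mu>0$ and $\rho>0$ there is a constant $c_R>0$, and for all $\alpha,\delta\in(0,1)$ there are constants $c_H,c_\delta,c'_\delta>0$ (determined by $d,\mu,\rho,\alpha,\delta$ only), such that the following holds for all $q\ge 1$, all side lengths $L_1,\dots,L_d\ge1$, all $h,\Delta>0$ with $h/\Delta=\rho$, and all real $R$ with $c_R\le R\le d\cdot\min_k L_k$. Let $H$ be translation-invariant, let $$\max_{i\in\Lambda}\sum_{S\ni i}e^{2\mu\,\mathrm{diam}\,S}\|H_S\|\le h,$$ and let $(H,|\mathbf 0\rangle)$ be $(\Delta,R)$-metastable. Then $H=H_0+V$, where $H_0=\sum_S H_{0,S}$ and $V=\sum_S V_S$ are decomposed in the same way, such that 1. $H_0|\mathbf 0\rangle=E_0|\mathbf 0\rangle$ for some $E_0\in\mathbb R$; 2. $(H_0,|\mathbf 0\rangle)$ is $\big(\Delta/2,\ \max(1,R_0)\big)$-metastable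 with $R_0=c'_\delta R^{1/2-\delta/d}$; 3. $\displaystyle\max_{i\in\Lambda}\sum_{S\ni i}e^{\frac25\mu\,\mathrm{diam}\,S}\|H_{0,S}\|\le c_H h$; 4. $\|V\|_{\mu}\le c_\delta\,h\,R^{\delta-d/2}$. -/

import Mathlib

open scoped Matrix.Norms.L2Operator

noncomputable section

namespace ManyBody

/-- Operators on the Hilbert space `⨂_{i ∈ V} ℂ^q`, as matrices in the computational basis, which
is indexed by the configurations `V → Fin q`.  The norm `‖·‖` on them is the operator norm. -/
abbrev Op (V : Type) (q : ℕ) [Fintype V] [DecidableEq V] : Type :=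
  Matrix (V → Fin q) (V → Fin q) ℂ

/-- (Unnormalized) state vectors, by their components in the computational basis. -/
abbrev Ket (V : Type) (q : ℕ) : Type := (V → Fin q) → ℂ

section General

variable {V : Type} [Fintype V] [DecidableEq V] {q : ℕ}

/-- The operator `A ⊗ I` where `A` acts on the qudits in `S` and `I` on those outside `S`. -/
def extend (S : Finset V) (A : Matrix (S → Fin q) (S → Fin q) ℂ) : Op V q :=
  Matrix.of fun σ τ =>
    if ∀ i, i ∉ S → σ i = τ i then A (fun i => σ i) (fun i => τ i) else 0

/-- The operator `O` is supported in `S`. -/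
def SupportedOn (S : Finset V) (O : Op V q) : Prop :=
  ∃ A : Matrix (S → Fin q) (S → Fin q) ℂ, O = extend S A

/-- The diameter of a set of sites, for the graph distance of `G`. -/
def diam (G : SimpleGraph V) (S : Finset V) : ℕ :=
  S.sup fun i => S.sup fun j => G.dist i j

/-- `S` is (nonempty and) connected by paths inside `S`. -/
def IsConn (G : SimpleGraph V) (S : Finset V) : Prop :=
  (G.induce (S : Set V)).Connected

/-- The expectation value `⟨ψ|O|ψ⟩ / ⟨ψ|ψ⟩`. -/
def expect (O : Op V q) (ψ : Ket V q) : ℂ :=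
  (star ψ ⬝ᵥ O.mulVec ψ) / (star ψ ⬝ᵥ ψ)

open Classical in
/-- The average energy of an unnormalized state for a Hermitian `H`; it is `+∞` for the zero
vector. -/
def energy (H : Op V q) (ψ : Ket V q) : EReal :=
  if ψ = 0 then ⊤ else (((expect H ψ).re : ℝ) : EReal)

/-- `(H, ψ)` is `(Δ, R)`-metastable: `R ≥ 1`, and every Hermitian operator `O` supported in a
connected set of diameter at most `R` either stabilizes `ψ` or raises the energy by at least `Δ`
(after the component of `O` that stabilizes `ψ` has been removed). -/
def IsMetastable (G : SimpleGraph V) (H : Op V q) (ψ : Ket V q) (Δ R : ℝ) : Prop :=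
  1 ≤ R ∧ ∀ S : Finset V, IsConn G S → (diam G S : ℝ) ≤ R →
    ∀ O : Op V q, SupportedOn S O → O.IsHermitian →
      (Δ : EReal) ≤ energy H ((O - expect O ψ • (1 : Op V q)).mulVec ψ) - energy H ψ

/-- The all-zero product state. -/
def ketZero [NeZero q] : Ket V q := Pi.single (fun _ => 0) 1

end General

/-- A Hamiltonian on the graph `G` together with a decomposition `∑_S H_S` into Hermitian local
terms, `H_S` being supported in `S` and only connected `S` occurring. -/
structure LocalHamiltonian {V : Type} [Fintype V] [DecidableEq V] (G : SimpleGraph V) (q : ℕ) where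
  term : Finset V → Op V q
  supported : ∀ S, SupportedOn S (term S)
  hermitian : ∀ S, (term S).IsHermitian
  connected : ∀ S, term S ≠ 0 → IsConn G S

namespace LocalHamiltonian

variable {V : Type} [Fintype V] [DecidableEq V] {G : SimpleGraph V} {q : ℕ}

/-- The Hamiltonian itself, the sum of its local terms. -/
def op (H : LocalHamiltonian G q) : Op V q := ∑ S, H.term S

/-- The local norm `max_i ∑_{S ∋ i} exp (κ (diam S)^α) ‖H_S‖`. For `α = 1` the weight is
`exp (κ diam S)`. -/
def localNorm (H : LocalHamiltonian G q) (κ α : ℝ) : ℝ :=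
  ⨆ i : V, ∑ S : Finset V with i ∈ S, Real.exp (κ * (diam G S : ℝ) ^ α) * ‖H.term S‖

end LocalHamiltonian

/-- The sites of the `d`-dimensional square lattice with periodic boundary conditions and side
lengths `L 0, …, L (d - 1)`. -/
abbrev Torus {d : ℕ} (L : Fin d → ℕ) : Type := ∀ k, ZMod (L k)

/-- Nearest-neighbour edges: distinct sites that differ by a unit vector. -/
def torusGraph {d : ℕ} (L : Fin d → ℕ) : SimpleGraph (Torus L) :=
  SimpleGraph.fromRel fun i j => ∃ k, j = i + Pi.single k 1

/-- Translation invariance on the torus: for every translation `x`, the term on `S + x` is the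
translate of the term on `S`. -/
def IsTranslationInvariant {d : ℕ} {L : Fin d → ℕ} [∀ k, NeZero (L k)] {q : ℕ}
    (H : LocalHamiltonian (torusGraph L) q) : Prop :=
  ∀ (x : Torus L) (S : Finset (Torus L)),
    H.term (S.image fun i => i + x) =
      (H.term S).submatrix (fun σ i => σ (i + x)) (fun σ i => σ (i + x))

end ManyBody

end

/-!
Write `E = ⟨0|H|0⟩` for the all-zero state `|0⟩`.  The obstruction to `|0⟩` being an eigenstate is
the vector `(H - E)|0⟩`, a superposition of configurations with a nonempty set of excited sites.
The operator `W` recreates exactly this vector, and `H₀ = H - W`.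

*Why the vector is small.*  Metastability of a product state says that every vector orthogonal to
`|0⟩` and excited only inside a region `B` of diameter at most `R` has energy at least `E + Δ`
(`IsMetastable.le_qform`).  Fix `j ∈ B` and let `w` be the part of `H|0⟩` on excitations of diameter
`r` in `B \ {j}`.  Exciting the site `j` costs energy at most `2h` whatever the state elsewhere
(`qform_flip_le`) and makes `|0⟩ - t w` orthogonal to `|0⟩`, so the energy of `|0⟩ - t w` is at
least `E - 2h`.  But that state has energy `E - (2t‖w‖² - t²⟨w|H - E|w⟩) / (1 + t²‖w‖²)`, and
`⟨w|H - E|w⟩` is at most a polynomial in `r` times `h‖w‖²`, by locality (`qform_le_of_diam_le`).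
Hence `‖w‖²` is at most a polynomial in `r` times `h²`, with no factor of the volume of `B`
(`sum_normSq_creation_le`).  By translation invariance this weight is shared equally among the
`~ R ^ d` sites of `B`, so the weight of the excitations that touch a given site is of order
`h² R ^ (-d)` (`creationWeight_le_of_box`).

*Why `W` is local.*  Every excitation is assigned to the ball around one of its excited sites whose
radius is its diameter `r`, and the parts `v` of `H|0⟩` collected in this way enter `W` as
`|v⟩⟨0| + |0⟩⟨v|` on that ball.  Such a part has norm at most `h e^{-2μr}`, since only terms of
diameter at least `r` create it, and at most a polynomial in `r` times `h R ^ (-d / 2)`.  The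
geometric mean of the two bounds, with exponent `δ / d` on the first, keeps an exponential decay in
`r` that beats the weight `e^{μ (2r)^α}`, and loses only a factor `R ^ (δ / 2)`
(`exists_sum_exp_norm_creation_le`).  The first bound alone gives the locality of `H₀`.

*Why `H₀` is metastable.*  On vectors excited only inside `S`, only the terms of `W` that meet `S`
contribute, so `W` changes the energy by at most `|S|` times its strength per site
(`abs_qform_op_le`), which is at most `Δ / 2` for `S` of diameter of order `R ^ (1/2 - δ/d)`.
-/

noncomputable section

set_option linter.unusedSectionVars false

namespace ManyBody

open Finset Matrix

/-! ### Quadratic forms and operator norms in the computational basis -/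

section Vectors

variable {V : Type} [Fintype V] [DecidableEq V] {q : ℕ}

/-- The squared norm `⟨ψ|ψ⟩`. -/
def nsq (ψ : Ket V q) : ℝ := ∑ σ, ‖ψ σ‖ ^ 2

/-- The real part of `⟨ψ|O|ψ⟩`, without normalization. -/
def qform (O : Op V q) (ψ : Ket V q) : ℝ := (star ψ ⬝ᵥ O *ᵥ ψ).re

lemma nsq_nonneg (ψ : Ket V q) : 0 ≤ nsq ψ := Finset.sum_nonneg fun _ _ => by positivity

lemma nsq_eq_norm_sq (ψ : Ket V q) : nsq ψ = ‖(WithLp.toLp 2 ψ : EuclideanSpace ℂ _)‖ ^ 2 := by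
  rw [EuclideanSpace.norm_sq_eq]; rfl

lemma star_dotProduct_self (ψ : Ket V q) : star ψ ⬝ᵥ ψ = (nsq ψ : ℂ) := by
  simp only [dotProduct, nsq, Pi.star_apply, Complex.ofReal_sum]
  refine Finset.sum_congr rfl fun σ _ => ?_
  rw [mul_comm, RCLike.star_def, RCLike.mul_conj]; simp

lemma nsq_pos {ψ : Ket V q} (h : ψ ≠ 0) : 0 < nsq ψ := by
  refine lt_of_le_of_ne (nsq_nonneg ψ) fun h0 => h ?_
  funext σ
  have := (Finset.sum_eq_zero_iff_of_nonneg (fun σ _ => by positivity)).1 h0.symm σ (mem_univ _)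
  simpa using this

lemma nsq_mulVec_le (O : Op V q) (ψ : Ket V q) : nsq (O *ᵥ ψ) ≤ ‖O‖ ^ 2 * nsq ψ := by
  rw [nsq_eq_norm_sq, nsq_eq_norm_sq, ← mul_pow]
  gcongr
  exact Matrix.l2_opNorm_mulVec O (WithLp.toLp 2 ψ)

lemma opNorm_le {O : Op V q} {c : ℝ} (hc : 0 ≤ c)
    (h : ∀ ψ, nsq (O *ᵥ ψ) ≤ c ^ 2 * nsq ψ) : ‖O‖ ≤ c := by
  rw [Matrix.l2_opNorm_def]
  refine ContinuousLinearMap.opNorm_le_bound _ hc fun x => ?_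
  have := h x.ofLp
  rw [nsq_eq_norm_sq, nsq_eq_norm_sq, ← mul_pow] at this
  exact le_of_sq_le_sq this (by positivity)

lemma abs_qform_le (O : Op V q) (ψ : Ket V q) : |qform O ψ| ≤ ‖O‖ * nsq ψ := by
  have h1 : star ψ ⬝ᵥ O *ᵥ ψ = inner ℂ (WithLp.toLp 2 ψ : EuclideanSpace ℂ _)
      (WithLp.toLp 2 (O *ᵥ ψ)) := by
    rw [EuclideanSpace.inner_toLp_toLp, dotProduct_comm]
  rw [qform, h1, nsq_eq_norm_sq, pow_two, ← mul_assoc, mul_comm (‖O‖ * _)]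
  refine (Complex.abs_re_le_norm _).trans ((norm_inner_le_norm _ _).trans ?_)
  gcongr
  exact Matrix.l2_opNorm_mulVec O (WithLp.toLp 2 ψ)

lemma qform_add (A B : Op V q) (ψ : Ket V q) : qform (A + B) ψ = qform A ψ + qform B ψ := by
  simp [qform, Matrix.add_mulVec, dotProduct_add]

lemma qform_sum {ι : Type*} (s : Finset ι) (A : ι → Op V q) (ψ : Ket V q) :
    qform (∑ i ∈ s, A i) ψ = ∑ i ∈ s, qform (A i) ψ := by
  simp [qform, Matrix.sum_mulVec, dotProduct_sum]

lemma qform_sub (A B : Op V q) (ψ : Ket V q) : qform (A - B) ψ = qform A ψ - qform B ψ := by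
  simp [qform, Matrix.sub_mulVec, dotProduct_sub]

lemma qform_eq_sum (O : Op V q) (ψ : Ket V q) :
    qform O ψ = ∑ σ, ∑ τ, (star (ψ σ) * O σ τ * ψ τ).re := by
  simp [qform, dotProduct, mulVec, Finset.mul_sum, mul_assoc]

lemma qform_real_smul_one (c : ℝ) (ψ : Ket V q) : qform ((c : ℂ) • (1 : Op V q)) ψ = c * nsq ψ := by
  rw [qform, Matrix.smul_mulVec, Matrix.one_mulVec, dotProduct_smul, star_dotProduct_self]
  simp

lemma nsq_smul (t : ℝ) (ψ : Ket V q) : nsq ((t : ℂ) • ψ) = t ^ 2 * nsq ψ := by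
  simp [nsq, mul_pow, Finset.mul_sum]

lemma nsq_single (σ : V → Fin q) : nsq (Pi.single σ 1 : Ket V q) = 1 := by
  rw [nsq, Finset.sum_eq_single σ] <;> simp +contextual

lemma nsq_col_le (O : Op V q) (τ : V → Fin q) : nsq (fun σ => O σ τ) ≤ ‖O‖ ^ 2 := by
  have := nsq_mulVec_le O (Pi.single τ 1)
  rw [nsq_single, mul_one, Matrix.mulVec_single_one] at this
  exact this

lemma norm_entry_le (O : Op V q) (σ τ : V → Fin q) : ‖O σ τ‖ ≤ ‖O‖ := by
  have h1 := nsq_col_le O τ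
  have h2 : ‖O σ τ‖ ^ 2 ≤ nsq (fun σ => O σ τ) :=
    Finset.single_le_sum (f := fun σ => ‖O σ τ‖ ^ 2) (fun _ _ => by positivity) (mem_univ σ)
  exact le_of_sq_le_sq (h2.trans h1) (norm_nonneg _)

lemma nsq_le_of_norm_le {φ ψ : Ket V q} (h : ∀ σ, ‖φ σ‖ ≤ ‖ψ σ‖) : nsq φ ≤ nsq ψ :=
  Finset.sum_le_sum fun σ _ => by gcongr; exact h σ

lemma sqrt_nsq_sum_le {ι : Type*} (s : Finset ι) (ψ : ι → Ket V q) :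
    √(nsq (∑ i ∈ s, ψ i)) ≤ ∑ i ∈ s, √(nsq (ψ i)) := by
  simp only [nsq_eq_norm_sq, Real.sqrt_sq (norm_nonneg _), WithLp.toLp_sum]
  exact norm_sum_le _ _

end Vectors

/-! ### Local operators and the support of a configuration -/

section Local

variable {V : Type} [Fintype V] [DecidableEq V] {q : ℕ}

lemma SupportedOn.eq_zero {S : Finset V} {O : Op V q} (h : SupportedOn S O) {σ τ : V → Fin q}
    {i : V} (hi : i ∉ S) (hne : σ i ≠ τ i) : O σ τ = 0 := by
  obtain ⟨A, rfl⟩ := h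
  exact if_neg fun h => hne (h i hi)

lemma SupportedOn.congr {S : Finset V} {O : Op V q} (h : SupportedOn S O) {σ τ σ' τ' : V → Fin q}
    (hst : ∀ i ∉ S, σ i = τ i) (hst' : ∀ i ∉ S, σ' i = τ' i)
    (hs : ∀ i ∈ S, σ i = σ' i) (ht : ∀ i ∈ S, τ i = τ' i) : O σ τ = O σ' τ' := by
  obtain ⟨A, rfl⟩ := h
  simp only [extend, Matrix.of_apply, if_pos hst, if_pos hst']
  congr 1
  · exact funext fun i => hs i i.2
  · exact funext fun i => ht i i.2

lemma SupportedOn.add {S : Finset V} {A B : Op V q} (hA : SupportedOn S A) (hB : SupportedOn S B) :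
    SupportedOn S (A + B) := by
  obtain ⟨A, rfl⟩ := hA
  obtain ⟨B, rfl⟩ := hB
  refine ⟨A + B, ?_⟩
  ext σ τ
  simp only [extend, Matrix.of_apply, Matrix.add_apply]
  split_ifs <;> simp

lemma SupportedOn.sub {S : Finset V} {A B : Op V q} (hA : SupportedOn S A) (hB : SupportedOn S B) :
    SupportedOn S (A - B) := by
  obtain ⟨A, rfl⟩ := hA
  obtain ⟨B, rfl⟩ := hB
  refine ⟨A - B, ?_⟩
  ext σ τ
  simp only [extend, Matrix.of_apply, Matrix.sub_apply]
  split_ifs <;> simp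

lemma SupportedOn.conjTranspose {S : Finset V} {A : Op V q} (hA : SupportedOn S A) :
    SupportedOn S Aᴴ := by
  obtain ⟨A, rfl⟩ := hA
  refine ⟨Aᴴ, ?_⟩
  ext σ τ
  simp only [extend, Matrix.of_apply, Matrix.conjTranspose_apply, eq_comm (a := σ _)]
  split_ifs <;> simp

variable [NeZero q]

/-- The set of excited sites of a configuration. -/
def supp (σ : V → Fin q) : Finset V := univ.filter fun i => σ i ≠ 0

/-- The configuration that agrees with `σ` on `S` and vanishes elsewhere. -/
def restr (S : Finset V) (σ : V → Fin q) : V → Fin q := fun i => if i ∈ S then σ i else 0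

lemma mem_supp {σ : V → Fin q} {i : V} : i ∈ supp σ ↔ σ i ≠ 0 := by simp [supp]

lemma supp_zero : supp (0 : V → Fin q) = ∅ := by ext; simp [mem_supp]

lemma supp_nonempty {σ : V → Fin q} : (supp σ).Nonempty ↔ σ ≠ 0 := by
  rw [Function.ne_iff]
  exact exists_congr fun i => mem_supp

lemma restr_eq_self {S : Finset V} {σ : V → Fin q} (h : supp σ ⊆ S) : restr S σ = σ := by
  funext i
  by_cases hi : i ∈ S
  · simp [restr, hi]
  · have : σ i = 0 := by by_contra h0; exact hi (h (mem_supp.2 h0))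
    simp [restr, hi, this]

lemma restr_compl_eq_zero {S : Finset V} {σ : V → Fin q} : restr Sᶜ σ = 0 ↔ supp σ ⊆ S := by
  simp only [funext_iff, restr, mem_compl, Pi.zero_apply, subset_iff, mem_supp]
  refine forall_congr' fun i => ?_
  by_cases hi : i ∈ S <;> simp [hi]

lemma ketZero_ne_zero : (ketZero : Ket V q) ≠ 0 := by
  intro h
  have := congrFun h 0
  simp [ketZero, Pi.single_apply, funext_iff] at this

lemma mulVec_ketZero (O : Op V q) : O *ᵥ ketZero = fun σ => O σ 0 := by
  rw [ketZero, Matrix.mulVec_single_one]; rfl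

lemma nsq_ketZero : nsq (ketZero : Ket V q) = 1 := nsq_single _

lemma star_ketZero_dotProduct (ψ : Ket V q) : star ketZero ⬝ᵥ ψ = ψ 0 := by
  have : star (ketZero : Ket V q) = Pi.single 0 1 := by
    ext σ
    by_cases h : σ = 0
    · subst h; simp [ketZero, Pi.zero_def]
    · have h' : ¬ σ = fun _ => 0 := h
      simp [ketZero, h, h']
  rw [this, single_one_dotProduct]

lemma qform_ketZero (O : Op V q) : qform O ketZero = (O 0 0).re := by
  rw [qform, star_ketZero_dotProduct, mulVec_ketZero]

lemma energy_eq (H : Op V q) {ψ : Ket V q} (h : ψ ≠ 0) :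
    energy H ψ = ((qform H ψ / nsq ψ : ℝ) : EReal) := by
  rw [energy, if_neg h, expect, star_dotProduct_self, Complex.div_ofReal_re]; rfl

lemma energy_ketZero (H : Op V q) : energy H ketZero = (((H 0 0).re : ℝ) : EReal) := by
  rw [energy_eq _ ketZero_ne_zero, nsq_ketZero, qform_ketZero, div_one]

lemma expect_ketZero (O : Op V q) : expect O ketZero = O 0 0 := by
  rw [expect, star_dotProduct_self, nsq_ketZero, star_ketZero_dotProduct, mulVec_ketZero]; simp

/-- The operator `|v⟩⟨0_S|` on the sites of `S`, where only the components of `v` on configurations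
supported in `S` are used. -/
def raising (v : Ket V q) (S : Finset V) : Op V q :=
  Matrix.of fun σ τ => if τ = restr Sᶜ σ then v (restr S σ) else 0

/-- The Hermitian operator `|v⟩⟨0_S| + |0_S⟩⟨v|` on the sites of `S`. -/
def excitation (v : Ket V q) (S : Finset V) : Op V q := raising v S + (raising v S)ᴴ

lemma raising_supportedOn (v : Ket V q) (S : Finset V) : SupportedOn S (raising v S) := by
  refine ⟨Matrix.of fun a b => if b = 0 then v (fun i => if h : i ∈ S then a ⟨i, h⟩ else 0) else 0,
    ?_⟩
  ext σ τ
  have h1 : τ = restr Sᶜ σ ↔ (∀ i ∉ S, σ i = τ i) ∧ (fun i : S => τ i) = 0 := by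
    simp only [funext_iff, restr, mem_compl, Pi.zero_apply, Subtype.forall]
    constructor
    · intro h
      exact ⟨fun i hi => by simp [h, hi], fun i hi => by simp [h, hi]⟩
    · rintro ⟨h1, h2⟩ i
      by_cases hi : i ∈ S
      · simp [hi, h2 i hi]
      · simp [hi, h1 i hi]
  simp only [raising, extend, Matrix.of_apply, h1, ite_and]
  rfl

lemma excitation_supportedOn (v : Ket V q) (S : Finset V) : SupportedOn S (excitation v S) :=
  (raising_supportedOn v S).add (raising_supportedOn v S).conjTranspose

lemma excitation_isHermitian (v : Ket V q) (S : Finset V) : (excitation v S).IsHermitian :=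
  Matrix.isHermitian_add_transpose_self _

lemma excitation_apply_zero {v : Ket V q} {S : Finset V} (hv : ∀ σ, v σ ≠ 0 → supp σ ⊆ S)
    (h0 : v 0 = 0) (σ : V → Fin q) : excitation v S σ 0 = v σ := by
  have h1 : restr S (0 : V → Fin q) = 0 := by ext; simp [restr]
  simp only [excitation, Matrix.add_apply, raising, Matrix.of_apply, Matrix.conjTranspose_apply, h1,
    h0, ite_self, star_zero, add_zero]
  by_cases h : supp σ ⊆ S
  · rw [if_pos (restr_compl_eq_zero.2 h).symm, restr_eq_self h]
  · rw [if_neg fun h2 => h (restr_compl_eq_zero.1 h2.symm)]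
    by_contra h2
    exact h (hv σ (Ne.symm h2))

/-- A configuration is determined by its restrictions to `S` and to the complement, so sums over
configurations are dominated by product sums. -/
lemma sum_restr_mul_le (S : Finset V) {F G : (V → Fin q) → ℝ} (hF : ∀ σ, 0 ≤ F σ)
    (hG : ∀ σ, 0 ≤ G σ) :
    ∑ σ, F (restr S σ) * G (restr Sᶜ σ) ≤ (∑ σ, F σ) * ∑ σ, G σ := by
  have hinj : Function.Injective fun σ : V → Fin q => (restr S σ, restr Sᶜ σ) := by
    intro σ τ h
    simp only [Prod.mk.injEq, funext_iff, restr] at h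
    funext i
    by_cases hi : i ∈ S
    · simpa [hi] using h.1 i
    · simpa [hi] using h.2 i
  rw [Finset.sum_mul_sum, ← Finset.sum_product']
  calc ∑ σ, F (restr S σ) * G (restr Sᶜ σ)
      = ∑ x ∈ univ.image fun σ : V → Fin q => (restr S σ, restr Sᶜ σ), F x.1 * G x.2 := by
        rw [Finset.sum_image fun a _ b _ h => hinj h]
    _ ≤ _ := Finset.sum_le_sum_of_subset_of_nonneg (by intro x _; simp)
        fun x _ _ => mul_nonneg (hF _) (hG _)

lemma norm_raising_le (v : Ket V q) (S : Finset V) : ‖raising v S‖ ≤ √(nsq v) := by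
  refine opNorm_le (Real.sqrt_nonneg _) fun y => ?_
  rw [Real.sq_sqrt (nsq_nonneg v)]
  have : ∀ σ, ‖(raising v S *ᵥ y) σ‖ ^ 2 = ‖v (restr S σ)‖ ^ 2 * ‖y (restr Sᶜ σ)‖ ^ 2 := by
    intro σ
    simp [raising, mulVec, dotProduct, mul_pow]
  simp only [nsq, this]
  exact sum_restr_mul_le S (F := fun σ => ‖v σ‖ ^ 2) (G := fun σ => ‖y σ‖ ^ 2)
    (fun _ => by positivity) fun _ => by positivity

lemma norm_excitation_le (v : Ket V q) (S : Finset V) : ‖excitation v S‖ ≤ 2 * √(nsq v) := by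
  refine (norm_add_le _ _).trans ?_
  rw [Matrix.l2_opNorm_conjTranspose, ← two_mul]
  gcongr
  exact norm_raising_le v S

lemma excitation_zero (S : Finset V) : excitation (0 : Ket V q) S = 0 := by
  ext σ τ
  simp [excitation, raising]

variable {G : SimpleGraph V}

/-- For the all-zero state, metastability bounds the quadratic form of `H` from below on all local
vectors orthogonal to that state: `|φ⟩⟨0| + |0⟩⟨φ|` creates any such vector `φ`. -/
lemma IsMetastable.le_qform {H : Op V q} {Δ R : ℝ} (hm : IsMetastable G H ketZero Δ R)
    {S : Finset V} (hS : IsConn G S) (hd : (diam G S : ℝ) ≤ R) {φ : Ket V q}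
    (hφ : ∀ σ, φ σ ≠ 0 → supp σ ⊆ S) (h0 : φ 0 = 0) :
    ((H 0 0).re + Δ) * nsq φ ≤ qform H φ := by
  by_cases hz : φ = 0
  · simp [hz, qform, nsq]
  have h := hm.2 S hS hd (excitation φ S) (excitation_supportedOn _ _) (excitation_isHermitian _ _)
  have h2 : (excitation φ S - expect (excitation φ S) ketZero • (1 : Op V q)) *ᵥ ketZero = φ := by
    rw [expect_ketZero, excitation_apply_zero hφ h0, h0, zero_smul, sub_zero, mulVec_ketZero]
    exact funext fun σ => excitation_apply_zero hφ h0 σ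
  rw [h2, energy_eq _ hz, energy_ketZero, ← EReal.coe_sub, EReal.coe_le_coe_iff,
    le_sub_iff_add_le', le_div_iff₀ (nsq_pos hz)] at h
  exact h

lemma isMetastable_of_le_qform {H : Op V q} {Δ R : ℝ} (hR : 1 ≤ R)
    (h : ∀ S : Finset V, IsConn G S → (diam G S : ℝ) ≤ R → ∀ φ : Ket V q,
      (∀ σ, φ σ ≠ 0 → supp σ ⊆ S) → φ 0 = 0 → ((H 0 0).re + Δ) * nsq φ ≤ qform H φ) :
    IsMetastable G H ketZero Δ R := by
  refine ⟨hR, fun S hS hd O hO _ => ?_⟩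
  rw [energy_ketZero]
  set φ := (O - expect O ketZero • (1 : Op V q)) *ᵥ ketZero with hφ
  by_cases hz : φ = 0
  · rw [energy, if_pos hz]; simp
  have key := h S hS hd φ ?_ ?_
  · rwa [energy_eq _ hz, ← EReal.coe_sub, EReal.coe_le_coe_iff, le_sub_iff_add_le',
      le_div_iff₀ (nsq_pos hz)]
  · intro σ hσ
    by_contra hsub
    obtain ⟨i, hi, hiS⟩ := Finset.not_subset.1 hsub
    have hne : σ ≠ 0 := fun h => by simp [h, mem_supp] at hi
    apply hσ
    rw [hφ, mulVec_ketZero]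
    simp [hO.eq_zero hiS (σ := σ) (τ := 0) (mem_supp.1 hi), hne]
  · rw [hφ, mulVec_ketZero]
    simp [expect_ketZero]

end Local

/-! ### Balls and diameters -/

section Graph

variable {V : Type} [Fintype V] [DecidableEq V] {G : SimpleGraph V}

/-- The closed ball of radius `r` around `x` for the graph distance. -/
def gball (G : SimpleGraph V) (x : V) (r : ℕ) : Finset V := univ.filter fun i => G.dist x i ≤ r

lemma mem_gball {x i : V} {r : ℕ} : i ∈ gball G x r ↔ G.dist x i ≤ r := by simp [gball]

lemma self_mem_gball (x : V) (r : ℕ) : x ∈ gball G x r := by simp [gball]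

lemma dist_le_diam {S : Finset V} {i j : V} (hi : i ∈ S) (hj : j ∈ S) :
    G.dist i j ≤ diam G S :=
  (Finset.le_sup (f := fun j => G.dist i j) hj).trans
    (Finset.le_sup (f := fun i => S.sup fun j => G.dist i j) hi)

lemma diam_le {S : Finset V} {n : ℕ} (h : ∀ i ∈ S, ∀ j ∈ S, G.dist i j ≤ n) : diam G S ≤ n :=
  Finset.sup_le fun i hi => Finset.sup_le fun j hj => h i hi j hj

lemma diam_mono {S T : Finset V} (h : S ⊆ T) : diam G S ≤ diam G T :=
  diam_le fun _ hi _ hj => dist_le_diam (h hi) (h hj)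

lemma diam_gball_le (hG : G.Connected) (x : V) (r : ℕ) : diam G (gball G x r) ≤ 2 * r := by
  refine diam_le fun i hi j hj => ?_
  rw [mem_gball] at hi hj
  have := hG.dist_triangle (u := i) (v := x) (w := j)
  rw [SimpleGraph.dist_comm (u := i) (v := x)] at this
  omega

lemma subset_gball_diam {S : Finset V} {x : V} (hx : x ∈ S) : S ⊆ gball G x (diam G S) :=
  fun _ hi => mem_gball.2 (dist_le_diam hx hi)

lemma isConn_gball (hG : G.Connected) (x : V) (r : ℕ) : IsConn G (gball G x r) := by
  have hx : x ∈ (gball G x r : Set V) := self_mem_gball x r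
  rw [IsConn, SimpleGraph.connected_iff_exists_forall_reachable]
  refine ⟨⟨x, hx⟩, ?_⟩
  -- a shortest path from `x` stays in the ball, so one can induct on the distance to `x`
  suffices h : ∀ n, ∀ y (hy : y ∈ (gball G x r : Set V)), G.dist x y = n →
      (G.induce (gball G x r : Set V)).Reachable ⟨x, hx⟩ ⟨y, hy⟩ from fun y => h _ y y.2 rfl
  intro n
  induction n with
  | zero =>
    intro y hy h0
    obtain rfl := hG.dist_eq_zero_iff.1 h0
    rfl
  | succ n ih =>
    intro y hy hn
    obtain ⟨p, hp⟩ := hG.exists_walk_length_eq_dist y x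
    rw [SimpleGraph.dist_comm, hn] at hp
    cases p with
    | nil => simp at hp
    | @cons _ z _ hadj p' =>
      have hz1 : G.dist x z ≤ n := by
        rw [SimpleGraph.dist_comm]
        exact (SimpleGraph.dist_le p').trans (by simpa using hp.le)
      have hz2 : n ≤ G.dist x z := by
        have h1 := hG.dist_triangle (u := x) (v := z) (w := y)
        rw [SimpleGraph.dist_eq_one_iff_adj.2 hadj.symm] at h1
        omega
      have hyr : G.dist x y ≤ r := mem_gball.1 hy
      have hz : z ∈ (gball G x r : Set V) := mem_gball.2 (by omega)
      exact (ih z hz (by omega)).trans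
        (SimpleGraph.Adj.reachable (G := G.induce _) (u := ⟨z, hz⟩) (v := ⟨y, hy⟩) hadj.symm)

end Graph

/-! ### The energy of weak superpositions of local excitations -/

section Energy

variable {V : Type} [Fintype V] [DecidableEq V] {G : SimpleGraph V} {q : ℕ}

lemma nsq_comp_equiv (e : Equiv.Perm (V → Fin q)) (ψ : Ket V q) :
    nsq (fun σ => ψ (e σ)) = nsq ψ :=
  Equiv.sum_comp e fun σ => ‖ψ σ‖ ^ 2

lemma qform_comp_equiv {O : Op V q} (e : Equiv.Perm (V → Fin q)) (ψ : Ket V q)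
    (hO : ∀ σ τ, O (e σ) (e τ) = O σ τ) : qform O (fun σ => ψ (e σ)) = qform O ψ := by
  rw [qform_eq_sum, qform_eq_sum, ← Equiv.sum_comp e fun σ => ∑ τ, (star (ψ σ) * O σ τ * ψ τ).re]
  refine Finset.sum_congr rfl fun σ _ => ?_
  rw [← Equiv.sum_comp e fun τ => (star (ψ (e σ)) * O (e σ) τ * ψ τ).re]
  exact Finset.sum_congr rfl fun τ _ => by rw [hO]

variable [NeZero q]

/-- The permutation of the configurations that exchanges the states `0` and `a` at site `j`. -/
def flip (j : V) (a : Fin q) : Equiv.Perm (V → Fin q) :=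
  Equiv.piCongrRight fun i => if i = j then Equiv.swap 0 a else 1

lemma flip_apply_of_ne {i j : V} (h : i ≠ j) (a : Fin q) (σ : V → Fin q) :
    flip j a σ i = σ i := by simp [flip, h]

lemma flip_apply_self (j : V) (a : Fin q) (σ : V → Fin q) :
    flip j a σ j = Equiv.swap 0 a (σ j) := by simp [flip]

/-- A unitary acting on a single site `j` changes the energy by at most twice the interaction
strength at `j`. -/
lemma qform_flip_le (H : LocalHamiltonian G q) {h : ℝ} {j : V}
    (hj : ∑ S : Finset V with j ∈ S, ‖H.term S‖ ≤ h) (a : Fin q) (ψ : Ket V q) :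
    qform H.op (fun σ => ψ (flip j a σ)) ≤ qform H.op ψ + 2 * h * nsq ψ := by
  have key : ∀ S, qform (H.term S) (fun σ => ψ (flip j a σ)) ≤ qform (H.term S) ψ +
      if j ∈ S then 2 * ‖H.term S‖ * nsq ψ else 0 := by
    intro S
    split_ifs with hS
    · have h1 := abs_le.1 (abs_qform_le (H.term S) (fun σ => ψ (flip j a σ)))
      have h2 := abs_le.1 (abs_qform_le (H.term S) ψ)
      rw [nsq_comp_equiv] at h1
      linarith [h1.2, h2.1]
    · rw [add_zero, qform_comp_equiv]
      intro σ τ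
      by_cases hst : ∀ i ∉ S, σ i = τ i
      · have hne : ∀ i ∈ S, i ≠ j := fun i hi h => hS (h ▸ hi)
        refine (H.supported S).congr (fun i hi => ?_) hst
          (fun i hi => flip_apply_of_ne (hne i hi) a σ) fun i hi => flip_apply_of_ne (hne i hi) a τ
        simp only [flip, Equiv.piCongrRight_apply, Pi.map_apply, hst i hi]
      · push Not at hst
        obtain ⟨i, hi, hne⟩ := hst
        rw [(H.supported S).eq_zero hi hne, (H.supported S).eq_zero hi]
        simp only [flip, Equiv.piCongrRight_apply, Pi.map_apply]
        exact fun h => hne (Equiv.injective _ h)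
  rw [LocalHamiltonian.op, qform_sum, qform_sum]
  refine (Finset.sum_le_sum fun S _ => key S).trans ?_
  rw [Finset.sum_add_distrib, ← Finset.sum_filter, ← Finset.sum_mul, ← Finset.mul_sum]
  have := nsq_nonneg ψ
  gcongr

lemma term_zero_zero (H : LocalHamiltonian G q) (S : Finset V) (σ : V → Fin q) :
    (((H.term S σ σ).re : ℝ) : ℂ) = H.term S σ σ :=
  (H.hermitian S).coe_re_apply_self σ

/-- For a superposition of excitations of diameter at most `r`, the local term on `S` sees only the
excitations within distance `r` of `S`. -/
lemma abs_qform_term_sub_le (H : LocalHamiltonian G q) {r : ℕ} {w : Ket V q}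
    (hw : ∀ σ, w σ ≠ 0 → σ ≠ 0 ∧ diam G (supp σ) ≤ r) (S : Finset V) :
    |qform (H.term S) w - (H.term S 0 0).re * nsq w| ≤ 2 * ‖H.term S‖ *
      ∑ σ, if ∃ i ∈ supp σ, ∃ s ∈ S, G.dist i s ≤ r then ‖w σ‖ ^ 2 else 0 := by
  classical
  set P : (V → Fin q) → Prop := fun σ => ∃ i ∈ supp σ, ∃ s ∈ S, G.dist i s ≤ r
  set A : Op V q := H.term S - (((H.term S 0 0).re : ℝ) : ℂ) • (1 : Op V q) with hA
  set u : Ket V q := fun σ => if P σ then w σ else 0 with hu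
  have hAu : qform A w = qform A u := by
    have key : ∀ σ τ, ¬ P τ → w σ ≠ 0 → w τ ≠ 0 → A σ τ = 0 ∧ A τ σ = 0 := by
      intro σ τ hτ hwσ hwτ
      have hτS : ∀ s ∈ S, τ s = 0 := by
        intro s hs
        by_contra h0
        exact hτ ⟨s, mem_supp.2 h0, s, hs, by simp⟩
      by_cases hst : ∀ i ∉ S, σ i = τ i
      · by_cases hσS : ∀ s ∈ S, σ s = 0
        · have heq : σ = τ := by
            funext i
            by_cases hi : i ∈ S
            · rw [hσS i hi, hτS i hi]
            · exact hst i hi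
          subst heq
          have : H.term S σ σ = H.term S 0 0 :=
            (H.supported S).congr (fun _ _ => rfl) (fun _ _ => rfl) hσS hσS
          simp [hA, term_zero_zero, this]
        · push Not at hσS
          obtain ⟨s, hs, hσs⟩ := hσS
          obtain ⟨i, hi⟩ := supp_nonempty.2 (hw τ hwτ).1
          have hiS : i ∉ S := fun h => mem_supp.1 hi (hτS i h)
          have hiσ : i ∈ supp σ := by rw [mem_supp, hst i hiS]; exact mem_supp.1 hi
          exact absurd ⟨i, hi, s, hs, (dist_le_diam hiσ (mem_supp.2 hσs)).trans (hw σ hwσ).2⟩ hτ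
      · push Not at hst
        obtain ⟨i, hi, hne⟩ := hst
        have hne' : σ ≠ τ := fun h => hne (congrFun h i)
        simp [hA, (H.supported S).eq_zero hi hne, (H.supported S).eq_zero hi hne.symm, hne',
          hne'.symm]
    rw [qform_eq_sum, qform_eq_sum]
    refine Finset.sum_congr rfl fun σ _ => Finset.sum_congr rfl fun τ _ => ?_
    by_cases h1 : w σ = 0
    · simp [hu, h1]
    by_cases h2 : w τ = 0
    · simp [hu, h2]
    by_cases h3 : P σ
    · by_cases h4 : P τ
      · simp [hu, h3, h4]
      · simp [hu, (key σ τ h4 h1 h2).1]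
    · simp [hu, (key τ σ h3 h2 h1).2]
  have h1 : qform A w = qform (H.term S) w - (H.term S 0 0).re * nsq w := by
    rw [hA, qform_sub, qform_real_smul_one]
  have h2 : nsq u = ∑ σ, if ∃ i ∈ supp σ, ∃ s ∈ S, G.dist i s ≤ r then ‖w σ‖ ^ 2 else 0 := by
    refine Finset.sum_congr rfl fun σ _ => ?_
    by_cases h : P σ
    · exact (congrArg (‖·‖ ^ 2) (if_pos h)).trans (if_pos h).symm
    · rw [if_neg (show ¬ ∃ i ∈ supp σ, ∃ s ∈ S, G.dist i s ≤ r from h)]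
      simp [hu, h]
  have h3 : |(H.term S 0 0).re| ≤ ‖H.term S‖ :=
    (Complex.abs_re_le_norm _).trans (norm_entry_le _ _ _)
  have hE : |(H.term S 0 0).re * nsq u| ≤ ‖H.term S‖ * nsq u := by
    rw [abs_mul, abs_of_nonneg (nsq_nonneg u)]
    exact mul_le_mul_of_nonneg_right h3 (nsq_nonneg u)
  rw [← h1, hAu, ← h2, hA, qform_sub, qform_real_smul_one]
  refine (abs_sub _ _).trans ?_
  linarith [abs_qform_le (H.term S) u]

/-- The energy density of a superposition of excitations of bounded diameter is bounded, however
many excitations are superposed. -/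
lemma qform_le_of_diam_le (hG : G.Connected) (H : LocalHamiltonian G q) {h : ℝ}
    (hH : ∀ i, ∑ S : Finset V with i ∈ S, ‖H.term S‖ ≤ h) {r : ℕ} {N : ℝ}
    (hN : ∀ x, ((gball G x (2 * r)).card : ℝ) ≤ N) {w : Ket V q} (h0 : 0 ≤ h)
    (hw : ∀ σ, w σ ≠ 0 → σ ≠ 0 ∧ diam G (supp σ) ≤ r) :
    qform H.op w ≤ ((H.op 0 0).re + 2 * N * h) * nsq w := by
  classical
  have h1 : ∀ S, qform (H.term S) w ≤ (H.term S 0 0).re * nsq w + 2 * ‖H.term S‖ *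
      ∑ σ, if ∃ i ∈ supp σ, ∃ s ∈ S, G.dist i s ≤ r then ‖w σ‖ ^ 2 else 0 := fun S => by
    linarith [(abs_le.1 (abs_qform_term_sub_le H hw S)).2]
  have h2 : ∀ σ, ∑ S, (if ∃ i ∈ supp σ, ∃ s ∈ S, G.dist i s ≤ r then
      ‖H.term S‖ * ‖w σ‖ ^ 2 else 0) ≤ N * h * ‖w σ‖ ^ 2 := by
    intro σ
    by_cases hσ : w σ = 0
    · simp [hσ]
    obtain ⟨x, hx⟩ := supp_nonempty.2 (hw σ hσ).1
    calc ∑ S, (if ∃ i ∈ supp σ, ∃ s ∈ S, G.dist i s ≤ r then ‖H.term S‖ * ‖w σ‖ ^ 2 else 0)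
        ≤ ∑ S, ∑ s ∈ gball G x (2 * r), if s ∈ S then ‖H.term S‖ * ‖w σ‖ ^ 2 else 0 := by
          refine Finset.sum_le_sum fun S _ => ?_
          have hnn : ∀ s, 0 ≤ if s ∈ S then ‖H.term S‖ * ‖w σ‖ ^ 2 else 0 := fun s => by
            split_ifs <;> positivity
          split_ifs with hP
          · obtain ⟨i, hi, s, hs, his⟩ := hP
            have hxs : s ∈ gball G x (2 * r) := by
              rw [mem_gball]
              have := hG.dist_triangle (u := x) (v := i) (w := s)
              have := (dist_le_diam (G := G) hx hi).trans (hw σ hσ).2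
              omega
            refine le_trans ?_ (Finset.single_le_sum (fun s _ => hnn s) hxs)
            rw [if_pos hs]
          · exact Finset.sum_nonneg fun s _ => hnn s
      _ = ∑ s ∈ gball G x (2 * r), (∑ S : Finset V with s ∈ S, ‖H.term S‖) * ‖w σ‖ ^ 2 := by
          rw [Finset.sum_comm]
          refine Finset.sum_congr rfl fun s _ => ?_
          rw [Finset.sum_mul, Finset.sum_filter]
      _ ≤ ∑ s ∈ gball G x (2 * r), h * ‖w σ‖ ^ 2 := by
          refine Finset.sum_le_sum fun s _ => ?_
          gcongr
          exact hH s
      _ = (gball G x (2 * r)).card * (h * ‖w σ‖ ^ 2) := by rw [Finset.sum_const, nsmul_eq_mul]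
      _ ≤ N * (h * ‖w σ‖ ^ 2) := by gcongr; exact hN x
      _ = _ := by ring
  have h3 : (H.op 0 0).re = ∑ S, (H.term S 0 0).re := by
    rw [LocalHamiltonian.op, Matrix.sum_apply, Complex.re_sum]
  have h4 : qform H.op w = ∑ S, qform (H.term S) w := by rw [LocalHamiltonian.op, qform_sum]
  have h5 : ∑ S, 2 * ‖H.term S‖ *
      (∑ σ, if ∃ i ∈ supp σ, ∃ s ∈ S, G.dist i s ≤ r then ‖w σ‖ ^ 2 else 0) =
      2 * ∑ σ, ∑ S, (if ∃ i ∈ supp σ, ∃ s ∈ S, G.dist i s ≤ r then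
        ‖H.term S‖ * ‖w σ‖ ^ 2 else 0) := by
    rw [Finset.sum_comm, Finset.mul_sum]
    refine Finset.sum_congr rfl fun S _ => ?_
    rw [mul_assoc, Finset.mul_sum]
    simp only [mul_ite, mul_zero]
  have h6 := Finset.sum_le_sum fun σ (_ : σ ∈ (univ : Finset (V → Fin q))) => h2 σ
  rw [← Finset.mul_sum] at h6
  rw [h4, h3]
  refine (Finset.sum_le_sum fun S _ => h1 S).trans ?_
  rw [Finset.sum_add_distrib, ← Finset.sum_mul, h5]
  change _ ≤ N * h * nsq w at h6
  linarith

lemma op_isHermitian (H : LocalHamiltonian G q) : H.op.IsHermitian := by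
  rw [LocalHamiltonian.op, Matrix.IsHermitian, Matrix.conjTranspose_sum]
  exact Finset.sum_congr rfl fun S _ => H.hermitian S

/-- The part of `H|0⟩` on excitations of diameter `r` inside a metastable region, away from one
site `j` of the region, has norm of order `h`, independently of the size of the region.  Otherwise
the state `|0⟩ - t w`, with `w` this part, would have an energy density so low that exciting it at
`j` gives a local state orthogonal to `|0⟩` and of energy below that of `|0⟩`. -/
lemma sum_normSq_creation_le (hG : G.Connected) (H : LocalHamiltonian G q) {h Δ R : ℝ}
    (hH : ∀ i, ∑ S : Finset V with i ∈ S, ‖H.term S‖ ≤ h) (hΔ : 0 ≤ Δ) (h0 : 0 < h)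
    (hm : IsMetastable G H.op ketZero Δ R) {B : Finset V} (hB : IsConn G B)
    (hBd : (diam G B : ℝ) ≤ R) {j : V} (hj : j ∈ B) {a : Fin q} (ha : a ≠ 0) (r : ℕ) {N : ℝ}
    (hN : ∀ x, ((gball G x (2 * r)).card : ℝ) ≤ N) :
    ∑ σ : V → Fin q with σ ≠ 0 ∧ supp σ ⊆ B.erase j ∧ diam G (supp σ) = r, ‖H.op σ 0‖ ^ 2 ≤
      8 * N * h ^ 2 := by
  classical
  set w : Ket V q := fun σ =>
    if σ ≠ 0 ∧ supp σ ⊆ B.erase j ∧ diam G (supp σ) = r then H.op σ 0 else 0 with hwdef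
  have hw : ∀ σ, w σ ≠ 0 → σ ≠ 0 ∧ supp σ ⊆ B.erase j ∧ diam G (supp σ) = r := by
    intro σ hσ
    by_contra hc
    exact hσ (if_neg hc)
  have hw0 : w 0 = 0 := by simp [hwdef]
  have hn : nsq w =
      ∑ σ : V → Fin q with σ ≠ 0 ∧ supp σ ⊆ B.erase j ∧ diam G (supp σ) = r, ‖H.op σ 0‖ ^ 2 := by
    rw [nsq, Finset.sum_filter]
    refine Finset.sum_congr rfl fun σ _ => ?_
    simp only [hwdef]
    split_ifs <;> simp
  rw [← hn]
  have hN1 : 1 ≤ N := by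
    refine le_trans ?_ (hN j)
    exact_mod_cast Finset.card_pos.2 ⟨j, self_mem_gball j _⟩
  have hw0H : star w ⬝ᵥ H.op *ᵥ ketZero = (nsq w : ℂ) := by
    rw [← star_dotProduct_self, mulVec_ketZero]
    refine Finset.sum_congr rfl fun σ _ => ?_
    by_cases hσ : w σ = 0
    · simp [hσ]
    · have : w σ = H.op σ 0 := if_pos (hw σ hσ)
      rw [this]
  have h0Hw : star ketZero ⬝ᵥ H.op *ᵥ w = (nsq w : ℂ) := by
    rw [star_ketZero_dotProduct, ← star_dotProduct_self, mulVec]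
    refine Finset.sum_congr rfl fun σ _ => ?_
    by_cases hσ : w σ = 0
    · simp [hσ]
    · have : w σ = H.op σ 0 := if_pos (hw σ hσ)
      rw [Pi.star_apply, this, (op_isHermitian H).apply]
  -- the exact minimizer of the quadratic upper bound for the energy below
  set t : ℝ := 1 / (2 * N * h + 2 * h) with ht
  have hden : 0 < 2 * N * h + 2 * h := by positivity
  set χ : Ket V q := ketZero - (t : ℂ) • w with hχ
  have hnχ : nsq χ = 1 + t ^ 2 * nsq w := by
    rw [← nsq_smul, ← nsq_ketZero (V := V) (q := q), nsq, nsq, nsq, ← Finset.sum_add_distrib]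
    refine Finset.sum_congr rfl fun σ _ => ?_
    by_cases hσ : σ = 0
    · subst hσ; simp [hχ, hw0]
    · have : (ketZero : Ket V q) σ = 0 := Pi.single_eq_of_ne hσ _
      simp [hχ, this]
  have hqχ : qform H.op χ = (H.op 0 0).re - 2 * t * nsq w + t ^ 2 * qform H.op w := by
    rw [← qform_ketZero]
    simp only [qform, hχ, Matrix.mulVec_sub, Matrix.mulVec_smul, star_sub, star_smul,
      sub_dotProduct, dotProduct_sub, smul_dotProduct, dotProduct_smul, hw0H, h0Hw,
      smul_eq_mul, RCLike.star_def, Complex.conj_ofReal, Complex.sub_re, Complex.re_ofReal_mul,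
      Complex.ofReal_re]
    ring
  have hqw := qform_le_of_diam_le hG H hH hN h0.le fun σ hσ => ⟨(hw σ hσ).1, (hw σ hσ).2.2.le⟩
  have hflip := qform_flip_le H (hH j) a χ
  have hmeta := hm.le_qform hB hBd (φ := fun σ => χ (flip j a σ)) ?_ ?_
  · rw [nsq_comp_equiv] at hmeta
    rw [hqχ, hnχ] at hflip
    rw [hnχ] at hmeta
    have hn0 := nsq_nonneg w
    have h1 : t ^ 2 * qform H.op w ≤ t ^ 2 * (((H.op 0 0).re + 2 * N * h) * nsq w) := by gcongr
    have h2 : 0 ≤ Δ * (1 + t ^ 2 * nsq w) := by positivity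
    have h3 : 2 * t * nsq w - t ^ 2 * nsq w * (2 * N * h + 2 * h) ≤ 2 * h := by nlinarith
    have h4 : t * (2 * N * h + 2 * h) = 1 := by rw [ht]; field_simp
    have h5 : t * nsq w ≤ 2 * h := by
      have : t ^ 2 * nsq w * (2 * N * h + 2 * h) = t * nsq w := by
        rw [show t ^ 2 * nsq w * (2 * N * h + 2 * h) =
          t * nsq w * (t * (2 * N * h + 2 * h)) by ring, h4, mul_one]
      linarith
    have h6 : nsq w ≤ 2 * h * (2 * N * h + 2 * h) := by
      calc nsq w = t * nsq w * (2 * N * h + 2 * h) := by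
            rw [mul_right_comm, h4, one_mul]
        _ ≤ _ := by gcongr
    nlinarith [sq_nonneg h]
  · intro σ hσ i hi
    by_cases hij : i = j
    · rw [hij]; exact hj
    have hi' : i ∈ supp (flip j a σ) := by
      rw [mem_supp, flip_apply_of_ne hij]; exact mem_supp.1 hi
    have hne : flip j a σ ≠ 0 := fun h => by simp [h, mem_supp] at hi'
    have : w (flip j a σ) ≠ 0 := by
      intro h
      have hk : (ketZero : Ket V q) (flip j a σ) = 0 := Pi.single_eq_of_ne hne _
      exact hσ (by simp [hχ, hk, h])
    exact Finset.mem_of_mem_erase ((hw _ this).2.1 hi')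
  · have hj0 : flip j a 0 j = a := by simp [flip_apply_self]
    have hne : flip j a 0 ≠ 0 := fun h => ha (by rw [← hj0, h]; rfl)
    have hk : (ketZero : Ket V q) (flip j a 0) = 0 := Pi.single_eq_of_ne hne _
    have : w (flip j a 0) = 0 := by
      by_contra h
      have := (hw _ h).2.1 (mem_supp.2 (by rw [hj0]; exact ha))
      simp at this
    simp [hχ, hk, this]

end Energy

/-! ### Geometry of the torus -/

section TorusGeometry

variable {d : ℕ} {L : Fin d → ℕ}

lemma torusGraph_adj {i j : Torus L} : (torusGraph L).Adj i j ↔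
    i ≠ j ∧ ((∃ k, j = i + Pi.single k 1) ∨ ∃ k, i = j + Pi.single k 1) := by
  simp [torusGraph, SimpleGraph.fromRel_adj]

lemma exists_walk_add_single (x : Torus L) (k : Fin d) (n : ℕ) :
    ∃ p : (torusGraph L).Walk x (x + Pi.single k (n : ZMod (L k))), p.length ≤ n := by
  induction n with
  | zero => exact ⟨SimpleGraph.Walk.nil.copy rfl (by simp), by simp⟩
  | succ n ih =>
    obtain ⟨p, hp⟩ := ih
    have he : x + Pi.single k ((n + 1 : ℕ) : ZMod (L k)) =
        x + Pi.single k (n : ZMod (L k)) + Pi.single k 1 := by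
      rw [add_assoc, ← Pi.single_add]; push_cast; rfl
    by_cases hne : x + Pi.single k (n : ZMod (L k)) = x + Pi.single k ((n + 1 : ℕ) : ZMod (L k))
    · exact ⟨p.copy rfl hne, by simpa using hp.trans (Nat.le_succ n)⟩
    · exact ⟨p.concat (torusGraph_adj.2 ⟨hne, Or.inl ⟨k, he⟩⟩), by simpa using hp⟩

lemma exists_walk_add (x : Torus L) (a : Fin d → ℕ) :
    ∃ p : (torusGraph L).Walk x (x + fun k => (a k : ZMod (L k))), p.length ≤ ∑ k, a k := by
  suffices h : ∀ s : Finset (Fin d), ∃ p : (torusGraph L).Walk x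
      (x + ∑ k ∈ s, Pi.single k (a k : ZMod (L k))), p.length ≤ ∑ k ∈ s, a k by
    have := h univ
    rwa [Finset.univ_sum_single fun k => (a k : ZMod (L k))] at this
  intro s
  induction s using Finset.induction_on with
  | empty => exact ⟨SimpleGraph.Walk.nil.copy rfl (by simp),
      by rw [SimpleGraph.Walk.length_copy]; simp⟩
  | insert k s hk ih =>
    obtain ⟨p, hp⟩ := ih
    obtain ⟨p', hp'⟩ := exists_walk_add_single (x + ∑ k ∈ s, Pi.single k (a k : ZMod (L k))) k (a k)
    refine ⟨(p.append p').copy rfl ?_, ?_⟩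
    · rw [Finset.sum_insert hk]; abel
    · rw [SimpleGraph.Walk.length_copy, SimpleGraph.Walk.length_append,
        Finset.sum_insert (f := a) hk]
      omega

lemma torusGraph_connected [∀ k, NeZero (L k)] : (torusGraph L).Connected := by
  rw [SimpleGraph.connected_iff_exists_forall_reachable]
  refine ⟨0, fun y => ?_⟩
  obtain ⟨p, -⟩ := exists_walk_add (0 : Torus L) fun k => (y k).val
  exact ⟨p.copy rfl (by funext k; simp)⟩

lemma dist_add_natCast_le (x : Torus L) (a : Fin d → ℕ) :
    (torusGraph L).dist x (x + fun k => (a k : ZMod (L k))) ≤ ∑ k, a k := by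
  obtain ⟨p, hp⟩ := exists_walk_add x a
  exact (SimpleGraph.dist_le p).trans hp

lemma exists_int_of_walk {x y : Torus L} (p : (torusGraph L).Walk x y) :
    ∃ z : Fin d → ℤ, (∀ k, |z k| ≤ p.length) ∧ y = x + fun k => (z k : ZMod (L k)) := by
  induction p with
  | nil => exact ⟨0, by simp, by funext k; simp⟩
  | @cons x u y hadj p ih =>
    obtain ⟨z, hz, rfl⟩ := ih
    have hcast : ∀ (k : Fin d) (c : ℤ), (fun l => ((Pi.single k c : Fin d → ℤ) l : ZMod (L l))) =
        Pi.single k (c : ZMod (L k)) := by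
      intro k c
      funext l
      by_cases h : l = k
      · subst h; simp
      · simp [h]
    have hstep : ∃ e : Fin d → ℤ, (∀ k, |e k| ≤ 1) ∧ u = x + fun k => (e k : ZMod (L k)) := by
      rcases (torusGraph_adj.1 hadj).2 with ⟨k, hk⟩ | ⟨k, hk⟩
      · refine ⟨Pi.single k 1, fun l => ?_, by rw [hcast, hk]; simp⟩
        by_cases h : l = k
        · subst h; simp
        · simp [h]
      · refine ⟨Pi.single k (-1), fun l => ?_, by rw [hcast, hk]; simp [add_assoc, ← Pi.single_add]⟩
        by_cases h : l = k
        · subst h; simp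
        · simp [h]
    obtain ⟨e, he, rfl⟩ := hstep
    refine ⟨e + z, fun k => ?_, ?_⟩
    · refine (abs_add_le _ _).trans ?_
      rw [SimpleGraph.Walk.length_cons]
      push_cast
      linarith [he k, hz k]
    · funext k; simp [add_assoc]

lemma card_gball_torus_le [∀ k, NeZero (L k)] (x : Torus L) (n : ℕ) :
    (gball (torusGraph L) x n).card ≤ (2 * n + 1) ^ d := by
  have hsub : gball (torusGraph L) x n ⊆
      (Fintype.piFinset fun _ : Fin d => Finset.Icc (-(n : ℤ)) n).image
        fun z => x + fun k => (z k : ZMod (L k)) := by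
    intro y hy
    rw [mem_gball] at hy
    obtain ⟨p, hp⟩ := torusGraph_connected.exists_walk_length_eq_dist x y
    obtain ⟨z, hz, hyz⟩ := exists_int_of_walk p
    refine Finset.mem_image.2 ⟨z, Fintype.mem_piFinset.2 fun k => ?_, hyz.symm⟩
    rw [Finset.mem_Icc, ← abs_le]
    exact (hz k).trans (by exact_mod_cast hp ▸ hy)
  refine (Finset.card_le_card hsub).trans (Finset.card_image_le.trans ?_)
  rw [Fintype.card_piFinset]
  simp only [Int.card_Icc, Finset.prod_const, Finset.card_univ, Fintype.card_fin]
  refine Nat.pow_le_pow_left ?_ d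
  omega

/-- The box `c + {0, …, m}^d`, wrapped around the torus in the directions of side at most `m`. -/
def box (c : Torus L) (m : ℕ) : Finset (Torus L) :=
  (Fintype.piFinset fun _ : Fin d => Finset.range (m + 1)).image
    fun a => c + fun k => (a k : ZMod (L k))

lemma card_box (c : Torus L) {m : ℕ} (hm : ∀ k, m < L k) : (box c m).card = (m + 1) ^ d := by
  rw [box, Finset.card_image_of_injOn]
  · simp [Fintype.card_piFinset]
  · intro a ha b hb hab
    simp only [Finset.mem_coe, Fintype.mem_piFinset, Finset.mem_range] at ha hb
    funext k
    have h := congrFun (add_left_cancel hab) k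
    rw [ZMod.natCast_eq_natCast_iff'] at h
    rwa [Nat.mod_eq_of_lt ((Nat.lt_succ_iff.1 (ha k)).trans_lt (hm k)),
      Nat.mod_eq_of_lt ((Nat.lt_succ_iff.1 (hb k)).trans_lt (hm k))] at h

lemma dist_le_of_mem_box {c x : Torus L} {m : ℕ} (hx : x ∈ box c m) :
    (torusGraph L).dist c x ≤ d * m := by
  simp only [box, Finset.mem_image, Fintype.mem_piFinset, Finset.mem_range] at hx
  obtain ⟨a, ha, rfl⟩ := hx
  refine (dist_add_natCast_le c a).trans ?_
  refine (Finset.sum_le_card_nsmul univ a m fun k _ => Nat.lt_succ_iff.1 (ha k)).trans ?_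
  simp

lemma dist_add_right_le [∀ k, NeZero (L k)] (i j x : Torus L) :
    (torusGraph L).dist (i + x) (j + x) ≤ (torusGraph L).dist i j := by
  let f : torusGraph L →g torusGraph L := ⟨fun i => i + x, fun {a b} hab => by
    rw [torusGraph_adj] at hab ⊢
    refine ⟨fun h => hab.1 (add_right_cancel h), hab.2.imp ?_ ?_⟩ <;>
    · rintro ⟨k, rfl⟩
      exact ⟨k, add_right_comm _ _ _⟩⟩
  obtain ⟨p, hp⟩ := torusGraph_connected.exists_walk_length_eq_dist i j
  have := SimpleGraph.dist_le (p.map f)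
  rwa [SimpleGraph.Walk.length_map, hp] at this

lemma dist_add_right [∀ k, NeZero (L k)] (i j x : Torus L) :
    (torusGraph L).dist (i + x) (j + x) = (torusGraph L).dist i j := by
  refine le_antisymm (dist_add_right_le i j x) ?_
  have := dist_add_right_le (i + x) (j + x) (-x)
  rwa [add_neg_cancel_right, add_neg_cancel_right] at this

end TorusGeometry

/-! ### Averaging over translations -/

section Averaging

variable {d : ℕ} {L : Fin d → ℕ} [∀ k, NeZero (L k)] {q : ℕ}

/-- Translation of configurations. -/
def shift (x : Torus L) : Equiv.Perm (Torus L → Fin q) := (Equiv.addRight (-x)).arrowCongr 1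

lemma shift_apply (x : Torus L) (σ : Torus L → Fin q) (i : Torus L) :
    shift x σ i = σ (i + x) := by
  simp [shift, Equiv.arrowCongr, Equiv.addRight]

lemma op_shift {H : LocalHamiltonian (torusGraph L) q} (hH : IsTranslationInvariant H)
    (x : Torus L) (σ τ : Torus L → Fin q) : H.op (shift x σ) (shift x τ) = H.op σ τ := by
  rw [LocalHamiltonian.op, Matrix.sum_apply, Matrix.sum_apply,
    ← Equiv.sum_comp (Equiv.addRight x).finsetCongr fun S => H.term S σ τ]
  refine Finset.sum_congr rfl fun S _ => ?_
  have : (Equiv.addRight x).finsetCongr S = S.image fun i => i + x := by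
    ext; simp [Equiv.finsetCongr]
  rw [this, hH x S]
  simp only [Matrix.submatrix_apply]
  congr 1 <;> funext i <;> exact shift_apply _ _ _

variable [NeZero q]

lemma supp_shift (x : Torus L) (σ : Torus L → Fin q) (i : Torus L) :
    i ∈ supp (shift x σ) ↔ i + x ∈ supp σ := by
  rw [mem_supp, mem_supp, shift_apply]

lemma diam_supp_shift_le (x : Torus L) (σ : Torus L → Fin q) :
    diam (torusGraph L) (supp (shift x σ)) ≤ diam (torusGraph L) (supp σ) := by
  refine diam_le fun i hi j hj => ?_
  rw [supp_shift] at hi hj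
  rw [← dist_add_right i j x]
  exact dist_le_diam hi hj

lemma diam_supp_shift (x : Torus L) (σ : Torus L → Fin q) :
    diam (torusGraph L) (supp (shift x σ)) = diam (torusGraph L) (supp σ) := by
  refine le_antisymm (diam_supp_shift_le x σ) ?_
  have := diam_supp_shift_le (-x) (shift x σ)
  have he : shift (-x) (shift x σ) = σ := by funext i; simp [shift_apply]
  rwa [he] at this

/-- The weight in `H|0⟩` of the excitations of diameter `r` that touch the site `x`. -/
def creationWeight {V : Type} [Fintype V] [DecidableEq V] {G : SimpleGraph V}
    (H : LocalHamiltonian G q) (r : ℕ) (x : V) : ℝ :=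
  ∑ σ : V → Fin q with x ∈ supp σ ∧ diam G (supp σ) = r, ‖H.op σ 0‖ ^ 2

lemma creationWeight_add {H : LocalHamiltonian (torusGraph L) q} (hH : IsTranslationInvariant H)
    (r : ℕ) (x y : Torus L) : creationWeight H r (x + y) = creationWeight H r x := by
  rw [creationWeight, creationWeight, Finset.sum_filter, Finset.sum_filter,
    ← Equiv.sum_comp (shift y) fun σ => if x ∈ supp σ ∧ _ then ‖H.op σ 0‖ ^ 2 else 0]
  refine Finset.sum_congr rfl fun σ _ => ?_
  have h0 : H.op (shift y σ) 0 = H.op σ 0 := by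
    rw [← op_shift hH y σ 0]
    congr 1
  simp only [supp_shift, diam_supp_shift, h0]

/-- Summing the weights over a set of sites counts each excitation at most as often as it has
excited sites. -/
lemma sum_creationWeight_le {V : Type} [Fintype V] [DecidableEq V] {G : SimpleGraph V}
    (H : LocalHamiltonian G q) {r : ℕ} {M : ℝ} (hM0 : 0 ≤ M)
    (hM : ∀ x, ((gball G x r).card : ℝ) ≤ M)
    {X B : Finset V} {j : V} (hXB : ∀ x ∈ X, gball G x r ⊆ B) (hXj : ∀ x ∈ X, r < G.dist x j) :
    ∑ x ∈ X, creationWeight H r x ≤ M *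
      ∑ σ : V → Fin q with σ ≠ 0 ∧ supp σ ⊆ B.erase j ∧ diam G (supp σ) = r, ‖H.op σ 0‖ ^ 2 := by
  have h1 : ∑ x ∈ X, creationWeight H r x = ∑ σ : V → Fin q, ∑ x ∈ X,
      if x ∈ supp σ ∧ diam G (supp σ) = r then ‖H.op σ 0‖ ^ 2 else 0 := by
    rw [Finset.sum_comm]
    exact Finset.sum_congr rfl fun x _ => by rw [creationWeight, Finset.sum_filter]
  rw [h1, Finset.mul_sum, Finset.sum_filter]
  refine Finset.sum_le_sum fun σ _ => ?_
  by_cases hex : ∃ x ∈ X, x ∈ supp σ ∧ diam G (supp σ) = r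
  · obtain ⟨x, hxX, hxσ, hr⟩ := hex
    have hsub : supp σ ⊆ gball G x r := hr ▸ subset_gball_diam hxσ
    rw [if_pos]
    · calc ∑ x ∈ X, (if x ∈ supp σ ∧ diam G (supp σ) = r then ‖H.op σ 0‖ ^ 2 else 0)
          ≤ ∑ x ∈ X, (if x ∈ supp σ then ‖H.op σ 0‖ ^ 2 else 0) := by
            refine Finset.sum_le_sum fun y _ => ?_
            by_cases hy : y ∈ supp σ <;> simp [hy, hr]
        _ = ((X.filter (· ∈ supp σ)).card : ℝ) * ‖H.op σ 0‖ ^ 2 := by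
            rw [← Finset.sum_filter, Finset.sum_const, nsmul_eq_mul]
        _ ≤ M * ‖H.op σ 0‖ ^ 2 := by
            gcongr
            refine le_trans ?_ (hM x)
            exact_mod_cast Finset.card_le_card fun y hy => hsub (Finset.mem_filter.1 hy).2
    · refine ⟨supp_nonempty.1 ⟨x, hxσ⟩, fun y hy =>
        Finset.mem_erase.2 ⟨?_, hXB x hxX (hsub hy)⟩, hr⟩
      rintro rfl
      exact absurd (mem_gball.1 (hsub hy)) (not_le.2 (hXj x hxX))
  · rw [Finset.sum_eq_zero fun x hx => if_neg fun h => hex ⟨x, hx, h⟩]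
    split_ifs <;> positivity

/-- For short-range excitations, averaging over the translations inside a metastable region gains
the inverse volume of the region. -/
lemma creationWeight_le_of_box (hd : 1 ≤ d) {H : LocalHamiltonian (torusGraph L) q} {h Δ R : ℝ}
    (hH : ∀ i, ∑ S : Finset (Torus L) with i ∈ S, ‖H.term S‖ ≤ h) (hΔ : 0 ≤ Δ) (h0 : 0 < h)
    (hT : IsTranslationInvariant H) (hm : IsMetastable (torusGraph L) H.op ketZero Δ R)
    {r m n : ℕ} (hn : (2 * n : ℝ) ≤ R) (hmn : d * m + r ≤ n) (hmL : ∀ k, m < L k)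
    (hrm : 2 * (2 * r + 1) ≤ m + 1) (x : Torus L) :
    (m + 1 : ℝ) ^ d * creationWeight H r x ≤ 16 * (4 * r + 1) ^ (2 * d) * h ^ 2 := by
  by_cases hq : ∃ a : Fin q, a ≠ 0
  swap
  · -- without excited states there is nothing to bound
    have : creationWeight H r x = 0 := by
      rw [creationWeight, Finset.filter_false_of_mem, Finset.sum_empty]
      rintro σ - ⟨hσ, -⟩
      exact hq ⟨_, mem_supp.1 hσ⟩
    rw [this, mul_zero]
    positivity
  obtain ⟨a, ha⟩ := hq
  have hG : (torusGraph L).Connected := torusGraph_connected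
  have hconst : ∀ y, creationWeight H r y = creationWeight H r x := fun y => by
    have := creationWeight_add hT r x (y - x)
    rwa [add_sub_cancel] at this
  have hF : 0 ≤ creationWeight H r x := Finset.sum_nonneg fun _ _ => by positivity
  set F := creationWeight H r x
  clear_value F
  set B := gball (torusGraph L) 0 n
  have hBd : (diam (torusGraph L) B : ℝ) ≤ R := le_trans (by exact_mod_cast diam_gball_le hG 0 n) hn
  have hball : ∀ (s : ℕ) (y : Torus L), ((gball (torusGraph L) y s).card : ℝ) ≤ (2 * s + 1) ^ d :=
    fun s y => by exact_mod_cast card_gball_torus_le y s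
  have hN : ∀ y, ((gball (torusGraph L) y (2 * r)).card : ℝ) ≤ (4 * r + 1) ^ d := fun y => by
    refine (hball _ y).trans (le_of_eq ?_)
    push_cast; ring
  have h1 := sum_normSq_creation_le hG H hH hΔ h0 hm (isConn_gball hG 0 n) hBd
    (self_mem_gball 0 n) ha r hN
  have h2 := sum_creationWeight_le H (by positivity) (hball r)
    (X := box 0 m \ gball (torusGraph L) 0 r) (B := B) (j := 0)
    (fun y hy z hz => by
      rw [mem_gball] at hz ⊢
      have := dist_le_of_mem_box (Finset.mem_sdiff.1 hy).1
      have := hG.dist_triangle (u := 0) (v := y) (w := z)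
      omega)
    (fun y hy => by
      have := (Finset.mem_sdiff.1 hy).2
      rw [mem_gball, SimpleGraph.dist_comm] at this
      omega)
  simp only [hconst, Finset.sum_const, nsmul_eq_mul] at h2
  have hcard : (m + 1 : ℝ) ^ d - (2 * r + 1) ^ d ≤
      ((box (0 : Torus L) m \ gball (torusGraph L) 0 r).card : ℝ) := by
    have h3 := Finset.le_card_sdiff (gball (torusGraph L) 0 r) (box (0 : Torus L) m)
    rw [card_box _ hmL] at h3
    have h4 := card_gball_torus_le (0 : Torus L) r
    have : (m + 1) ^ d ≤ (box (0 : Torus L) m \ gball (torusGraph L) 0 r).card + (2 * r + 1) ^ d := by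
      omega
    have : ((m + 1 : ℝ)) ^ d ≤
        (box (0 : Torus L) m \ gball (torusGraph L) 0 r).card + (2 * r + 1 : ℝ) ^ d := by
      exact_mod_cast this
    linarith
  -- the excluded ball around the flipped site takes up at most half of the box
  have hhalf : 2 * (2 * r + 1 : ℝ) ^ d ≤ (m + 1) ^ d := by
    calc 2 * (2 * r + 1 : ℝ) ^ d ≤ 2 ^ d * (2 * r + 1) ^ d := by
          gcongr
          exact le_self_pow₀ (by norm_num) (by omega)
      _ = (2 * (2 * r + 1)) ^ d := by rw [mul_pow]
      _ ≤ (m + 1) ^ d := by gcongr; exact_mod_cast hrm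
  have h5 : (m + 1 : ℝ) ^ d / 2 * F ≤ (2 * r + 1) ^ d * (8 * (4 * r + 1) ^ d * h ^ 2) := by
    refine le_trans ?_ (h2.trans (mul_le_mul_of_nonneg_left h1 (by positivity)))
    gcongr
    linarith
  have h6 : (2 * r + 1 : ℝ) ^ d ≤ (4 * r + 1) ^ d := by gcongr; linarith
  calc (m + 1 : ℝ) ^ d * F = 2 * ((m + 1 : ℝ) ^ d / 2 * F) := by ring
    _ ≤ 2 * ((4 * r + 1) ^ d * (8 * (4 * r + 1) ^ d * h ^ 2)) := by
        have : 0 ≤ 8 * (4 * r + 1 : ℝ) ^ d * h ^ 2 := by positivity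
        linarith [mul_le_mul_of_nonneg_right h6 this]
    _ = _ := by rw [pow_mul']; ring

end Averaging

/-! ### The operator that creates the excitations of `H|0⟩` -/

section Decomposition

variable {V : Type} [Fintype V] [DecidableEq V] {G : SimpleGraph V} {q : ℕ} [NeZero q]

/-- `σ` has excited sites, the one chosen as its anchor is `x`, and its diameter is `r`. -/
def IsAnchored (G : SimpleGraph V) (x : V) (r : ℕ) (σ : V → Fin q) : Prop :=
  ∃ h : (supp σ).Nonempty, h.choose = x ∧ diam G (supp σ) = r

lemma IsAnchored.mem_supp {x : V} {r : ℕ} {σ : V → Fin q} (h : IsAnchored G x r σ) :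
    x ∈ supp σ := h.elim fun hn hx => hx.1 ▸ hn.choose_spec

lemma exists_isAnchored {σ : V → Fin q} (h : σ ≠ 0) : ∃ x, IsAnchored G x (diam G (supp σ)) σ :=
  ⟨_, supp_nonempty.2 h, rfl, rfl⟩

lemma IsAnchored.unique {x y : V} {r s : ℕ} {σ : V → Fin q} (h : IsAnchored G x r σ)
    (h' : IsAnchored G y s σ) : x = y ∧ r = s := by
  obtain ⟨h1, rfl, rfl⟩ := h
  obtain ⟨h2, rfl, rfl⟩ := h'
  exact ⟨rfl, rfl⟩

open Classical in
/-- The part of `H|0⟩` on excitations with anchor `x` and diameter `r`. -/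
def anchoredPart (H : LocalHamiltonian G q) (x : V) (r : ℕ) : Ket V q :=
  fun σ => if IsAnchored G x r σ then H.op σ 0 else 0

/-- The part of `H|0⟩` on excitations that are assigned to the set `S`, where an excitation is
assigned to the ball around its anchor whose radius is the diameter of the excitation. -/
def ballPart (H : LocalHamiltonian G q) (S : Finset V) : Ket V q :=
  ∑ p ∈ (univ ×ˢ range (diam G univ + 1)).filter fun p : V × ℕ => gball G p.1 p.2 = S,
    anchoredPart H p.1 p.2

lemma ballPart_ne_zero {H : LocalHamiltonian G q} {S : Finset V} {σ : V → Fin q}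
    (h : ballPart H S σ ≠ 0) : ∃ x r, gball G x r = S ∧ IsAnchored G x r σ := by
  rw [ballPart, Finset.sum_apply] at h
  obtain ⟨p, hp, hne⟩ := Finset.exists_ne_zero_of_sum_ne_zero h
  refine ⟨p.1, p.2, (Finset.mem_filter.1 hp).2, ?_⟩
  by_contra hc
  exact hne (if_neg hc)

lemma supp_subset_of_ballPart_ne_zero {H : LocalHamiltonian G q} {S : Finset V} {σ : V → Fin q}
    (h : ballPart H S σ ≠ 0) : supp σ ⊆ S := by
  obtain ⟨x, r, rfl, hx⟩ := ballPart_ne_zero h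
  obtain ⟨hn, -, rfl⟩ := id hx
  exact subset_gball_diam hx.mem_supp

lemma ballPart_zero (H : LocalHamiltonian G q) (S : Finset V) : ballPart H S 0 = 0 := by
  by_contra h
  obtain ⟨x, r, -, hx⟩ := ballPart_ne_zero h
  have := hx.mem_supp
  simp [supp_zero] at this

/-- The decomposition `∑_S (|v_S⟩⟨0_S| + |0_S⟩⟨v_S|)` of an operator whose action on `|0⟩` is that
of `H`, apart from the component of `H|0⟩` on `|0⟩` itself. -/
def creationHamiltonian (hG : G.Connected) (H : LocalHamiltonian G q) : LocalHamiltonian G q where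
  term S := excitation (ballPart H S) S
  supported S := excitation_supportedOn _ _
  hermitian S := excitation_isHermitian _ _
  connected S hS := by
    have : ballPart H S ≠ 0 := fun h => hS (by rw [h, excitation_zero])
    obtain ⟨σ, hσ⟩ := Function.ne_iff.1 this
    obtain ⟨x, r, rfl, -⟩ := ballPart_ne_zero hσ
    exact isConn_gball hG x r

/-- The Hamiltonian `H` without the terms that create excitations from `|0⟩`. -/
def stabilizedHamiltonian (hG : G.Connected) (H : LocalHamiltonian G q) :
    LocalHamiltonian G q where
  term S := H.term S - (creationHamiltonian hG H).term S
  supported S := (H.supported S).sub ((creationHamiltonian hG H).supported S)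
  hermitian S := (H.hermitian S).sub ((creationHamiltonian hG H).hermitian S)
  connected S hS := by
    by_cases h : H.term S = 0
    · exact (creationHamiltonian hG H).connected S fun h' => hS (by rw [h, h', sub_zero])
    · exact H.connected S h

lemma op_eq_stabilized_add_creation (hG : G.Connected) (H : LocalHamiltonian G q) :
    H.op = (stabilizedHamiltonian hG H).op + (creationHamiltonian hG H).op := by
  rw [LocalHamiltonian.op, LocalHamiltonian.op, LocalHamiltonian.op, ← Finset.sum_add_distrib]
  exact Finset.sum_congr rfl fun S _ => (sub_add_cancel _ _).symm

lemma creationHamiltonian_term_apply_zero (hG : G.Connected) (H : LocalHamiltonian G q)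
    (S : Finset V) (σ : V → Fin q) :
    (creationHamiltonian hG H).term S σ 0 = ballPart H S σ :=
  excitation_apply_zero (fun _ h => supp_subset_of_ballPart_ne_zero h) (ballPart_zero H S) σ

lemma creationHamiltonian_op_apply_zero (hG : G.Connected) (H : LocalHamiltonian G q)
    {σ : V → Fin q} (hσ : σ ≠ 0) : (creationHamiltonian hG H).op σ 0 = H.op σ 0 := by
  classical
  obtain ⟨x, hx⟩ := exists_isAnchored (G := G) hσ
  rw [LocalHamiltonian.op, Matrix.sum_apply]
  simp only [creationHamiltonian_term_apply_zero, ballPart, Finset.sum_apply]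
  rw [Finset.sum_fiberwise_of_maps_to (fun _ _ => mem_univ _)
    fun p : V × ℕ => anchoredPart H p.1 p.2 σ, Finset.sum_eq_single (x, diam G (supp σ))]
  · exact if_pos hx
  · rintro ⟨y, s⟩ - hne
    refine if_neg fun h => hne ?_
    obtain ⟨rfl, rfl⟩ := h.unique hx
    rfl
  · intro h
    refine absurd (Finset.mem_product.2 ⟨mem_univ _, Finset.mem_range.2 ?_⟩) h
    exact Nat.lt_succ_of_le (diam_mono (subset_univ _))

lemma creationHamiltonian_term_zero_zero (hG : G.Connected) (H : LocalHamiltonian G q)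
    (S : Finset V) : (creationHamiltonian hG H).term S 0 0 = 0 := by
  rw [creationHamiltonian_term_apply_zero, ballPart_zero]

lemma creationHamiltonian_op_zero_zero (hG : G.Connected) (H : LocalHamiltonian G q) :
    (creationHamiltonian hG H).op 0 0 = 0 := by
  rw [LocalHamiltonian.op, Matrix.sum_apply]
  exact Finset.sum_eq_zero fun S _ => creationHamiltonian_term_zero_zero hG H S

lemma stabilizedHamiltonian_zero_zero (hG : G.Connected) (H : LocalHamiltonian G q) :
    (stabilizedHamiltonian hG H).op 0 0 = H.op 0 0 := by
  rw [op_eq_stabilized_add_creation hG H, Matrix.add_apply, creationHamiltonian_op_zero_zero,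
    add_zero]

lemma stabilizedHamiltonian_mulVec_ketZero (hG : G.Connected) (H : LocalHamiltonian G q) :
    (stabilizedHamiltonian hG H).op *ᵥ ketZero = (((H.op 0 0).re : ℝ) : ℂ) • ketZero := by
  have hre : (((H.op 0 0).re : ℝ) : ℂ) = H.op 0 0 := (op_isHermitian H).coe_re_apply_self 0
  rw [mulVec_ketZero, hre]
  funext σ
  by_cases hσ : σ = 0
  · have : (ketZero : Ket V q) 0 = 1 := Pi.single_eq_same _ _
    rw [hσ, stabilizedHamiltonian_zero_zero, Pi.smul_apply, this, smul_eq_mul, mul_one]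
  · have h1 : (ketZero : Ket V q) σ = 0 := Pi.single_eq_of_ne hσ _
    have h2 : H.op σ 0 = (stabilizedHamiltonian hG H).op σ 0 + H.op σ 0 := by
      conv_lhs => rw [op_eq_stabilized_add_creation hG H, Matrix.add_apply,
        creationHamiltonian_op_apply_zero hG H hσ]
    rw [Pi.smul_apply, h1, smul_zero]
    simpa using h2

lemma sqrt_nsq_anchoredPart_le (H : LocalHamiltonian G q) (x : V) (r : ℕ) :
    √(nsq (anchoredPart H x r)) ≤ √(creationWeight H r x) := by
  classical
  refine Real.sqrt_le_sqrt ?_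
  rw [nsq, creationWeight, Finset.sum_filter]
  refine Finset.sum_le_sum fun σ _ => ?_
  by_cases h : IsAnchored G x r σ
  · rw [if_pos ⟨h.mem_supp, h.elim fun _ h => h.2⟩, anchoredPart, if_pos h]
  · rw [anchoredPart, if_neg h]
    split_ifs <;> simp

/-- Excitations of diameter `r` are created only by terms of diameter at least `r`. -/
lemma sqrt_nsq_anchoredPart_le_exp {H : LocalHamiltonian G q} {κ h : ℝ} (hκ : 0 ≤ κ)
    (hH : ∀ i, ∑ S : Finset V with i ∈ S, Real.exp (κ * diam G S) * ‖H.term S‖ ≤ h)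
    (x : V) (r : ℕ) : √(nsq (anchoredPart H x r)) ≤ h * Real.exp (-(κ * r)) := by
  classical
  set u : Finset V → Ket V q := fun S σ => if IsAnchored G x r σ then H.term S σ 0 else 0 with hu
  have h1 : anchoredPart H x r = ∑ S : Finset V with x ∈ S ∧ r ≤ diam G S, u S := by
    funext σ
    rw [Finset.sum_apply, anchoredPart]
    split_ifs with hσ
    · rw [LocalHamiltonian.op, Matrix.sum_apply, Finset.sum_filter]
      refine Finset.sum_congr rfl fun S _ => ?_
      simp only [hu, if_pos hσ]
      split_ifs with hS
      · rfl
      · by_cases hsub : supp σ ⊆ S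
        · refine absurd ⟨hsub hσ.mem_supp, ?_⟩ hS
          obtain ⟨-, -, rfl⟩ := hσ
          exact diam_mono hsub
        · obtain ⟨i, hi, hiS⟩ := Finset.not_subset.1 hsub
          exact (H.supported S).eq_zero hiS (ManyBody.mem_supp.1 hi)
    · exact (Finset.sum_eq_zero fun S _ => if_neg hσ).symm
  rw [h1]
  calc √(nsq (∑ S : Finset V with x ∈ S ∧ r ≤ diam G S, u S))
      ≤ ∑ S : Finset V with x ∈ S ∧ r ≤ diam G S, √(nsq (u S)) := sqrt_nsq_sum_le _ _
    _ ≤ ∑ S : Finset V with x ∈ S ∧ r ≤ diam G S,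
          Real.exp (κ * diam G S) * ‖H.term S‖ * Real.exp (-(κ * r)) := by
        refine Finset.sum_le_sum fun S hS => ?_
        have h2 : √(nsq (u S)) ≤ ‖H.term S‖ := by
          rw [Real.sqrt_le_left (norm_nonneg _)]
          refine (nsq_le_of_norm_le fun σ => ?_).trans (nsq_col_le (H.term S) 0)
          simp only [hu]
          split_ifs <;> simp
        have h3 : 1 ≤ Real.exp (κ * diam G S) * Real.exp (-(κ * r)) := by
          rw [← Real.exp_add, Real.one_le_exp_iff]
          have : (r : ℝ) ≤ diam G S := by exact_mod_cast (Finset.mem_filter.1 hS).2.2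
          nlinarith
        nlinarith [norm_nonneg (H.term S)]
    _ ≤ ∑ S : Finset V with x ∈ S,
          Real.exp (κ * diam G S) * ‖H.term S‖ * Real.exp (-(κ * r)) := by
        refine Finset.sum_le_sum_of_subset_of_nonneg ?_ fun _ _ _ => by positivity
        intro S hS
        simp only [Finset.mem_filter] at hS ⊢
        exact ⟨hS.1, hS.2.1⟩
    _ ≤ h * Real.exp (-(κ * r)) := by
        rw [← Finset.sum_mul]
        exact mul_le_mul_of_nonneg_right (hH x) (Real.exp_nonneg _)

/-- The interaction strength of the creation terms, from bounds on the parts of `H|0⟩`. -/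
lemma sum_norm_creation_le (hG : G.Connected) (H : LocalHamiltonian G q) {b c g : ℕ → ℝ}
    (hb : ∀ x r, √(nsq (anchoredPart H x r)) ≤ b r) (hc : ∀ x r, ((gball G x r).card : ℝ) ≤ c r)
    (hg0 : ∀ r, 0 ≤ g r) (hg : Monotone g) (i : V) :
    ∑ S : Finset V with i ∈ S, g (diam G S) * ‖(creationHamiltonian hG H).term S‖ ≤
      ∑ r ∈ range (diam G univ + 1), c r * (g (2 * r) * (2 * b r)) := by
  have hb0 : ∀ r, 0 ≤ b r := fun r => (Real.sqrt_nonneg _).trans (hb i r)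
  calc ∑ S : Finset V with i ∈ S, g (diam G S) * ‖(creationHamiltonian hG H).term S‖
      ≤ ∑ S : Finset V with i ∈ S, ∑ p ∈ (univ ×ˢ range (diam G univ + 1)).filter
          fun p : V × ℕ => gball G p.1 p.2 = S,
            if i ∈ gball G p.1 p.2 then g (2 * p.2) * (2 * b p.2) else 0 := by
        refine Finset.sum_le_sum fun S hS => ?_
        rw [Finset.mem_filter] at hS
        have h1 : ‖(creationHamiltonian hG H).term S‖ ≤
            2 * ∑ p ∈ (univ ×ˢ range (diam G univ + 1)).filter
              fun p : V × ℕ => gball G p.1 p.2 = S, √(nsq (anchoredPart H p.1 p.2)) := by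
          refine (norm_excitation_le _ _).trans ?_
          gcongr
          exact sqrt_nsq_sum_le _ _
        refine (mul_le_mul_of_nonneg_left h1 (hg0 _)).trans ?_
        rw [Finset.mul_sum, Finset.mul_sum]
        refine Finset.sum_le_sum fun p hp => ?_
        rw [Finset.mem_filter] at hp
        rw [hp.2, if_pos hS.2]
        have h2 : diam G S ≤ 2 * p.2 := hp.2 ▸ diam_gball_le hG p.1 p.2
        have := hb p.1 p.2
        have := hg0 (2 * p.2)
        gcongr
        exact hg h2
    _ ≤ ∑ S : Finset V, ∑ p ∈ (univ ×ˢ range (diam G univ + 1)).filter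
          fun p : V × ℕ => gball G p.1 p.2 = S,
            if i ∈ gball G p.1 p.2 then g (2 * p.2) * (2 * b p.2) else 0 := by
        refine Finset.sum_le_sum_of_subset_of_nonneg (Finset.filter_subset _ _) fun S _ _ => ?_
        refine Finset.sum_nonneg fun p _ => ?_
        have := hb0 p.2
        have := hg0 (2 * p.2)
        split_ifs <;> positivity
    _ = ∑ p ∈ univ ×ˢ range (diam G univ + 1),
          if i ∈ gball G p.1 p.2 then g (2 * p.2) * (2 * b p.2) else 0 :=
        Finset.sum_fiberwise_of_maps_to (fun _ _ => mem_univ _) _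
    _ = ∑ r ∈ range (diam G univ + 1), (gball G i r).card * (g (2 * r) * (2 * b r)) := by
        rw [Finset.sum_product_right]
        refine Finset.sum_congr rfl fun r _ => ?_
        rw [← Finset.sum_filter]
        dsimp only
        rw [Finset.sum_const, nsmul_eq_mul]
        congr 3
        ext x
        simp [mem_gball, SimpleGraph.dist_comm]
    _ ≤ _ := by
        refine Finset.sum_le_sum fun r _ => ?_
        have := hb0 r
        have := hg0 (2 * r)
        gcongr
        exact hc i r

/-- On vectors that are excited only inside `S`, only the terms that meet `S` contribute to a
Hamiltonian all of whose terms have expectation value zero at `|0⟩`. -/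
lemma abs_qform_op_le {W : LocalHamiltonian G q} (hW0 : ∀ S, W.term S 0 0 = 0) {w : ℝ}
    (hW : ∀ i, ∑ S : Finset V with i ∈ S, ‖W.term S‖ ≤ w) {S : Finset V} {φ : Ket V q}
    (hφ : ∀ σ, φ σ ≠ 0 → supp σ ⊆ S) : |qform W.op φ| ≤ S.card * w * nsq φ := by
  have key : ∀ T, |qform (W.term T) φ| ≤ ∑ i ∈ S, if i ∈ T then ‖W.term T‖ * nsq φ else 0 := by
    intro T
    have hnn : ∀ i, 0 ≤ if i ∈ T then ‖W.term T‖ * nsq φ else 0 := fun i => by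
      have := nsq_nonneg φ
      split_ifs <;> positivity
    by_cases hT : ∃ i ∈ S, i ∈ T
    · obtain ⟨i, hiS, hiT⟩ := hT
      refine (abs_qform_le _ _).trans (le_trans ?_ (Finset.single_le_sum (fun i _ => hnn i) hiS))
      rw [if_pos hiT]
    · have hz : ∀ σ, φ σ ≠ 0 → ∀ i ∈ T, σ i = 0 := fun σ hσ i hi => by
        by_contra h
        exact hT ⟨i, hφ σ hσ (mem_supp.2 h), hi⟩
      rw [qform_eq_sum, Finset.sum_eq_zero, abs_zero]
      · exact Finset.sum_nonneg fun i _ => hnn i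
      · refine fun σ _ => Finset.sum_eq_zero fun τ _ => ?_
        by_cases hσ : φ σ = 0
        · simp [hσ]
        by_cases hτ : φ τ = 0
        · simp [hτ]
        have : W.term T σ τ = 0 := by
          by_cases hst : ∀ i ∉ T, σ i = τ i
          · rw [← hW0 T]
            exact (W.supported T).congr hst (fun _ _ => rfl) (hz σ hσ) (hz τ hτ)
          · push Not at hst
            obtain ⟨i, hi, hne⟩ := hst
            exact (W.supported T).eq_zero hi hne
        simp [this]
  rw [LocalHamiltonian.op, qform_sum]
  refine (Finset.abs_sum_le_sum_abs _ _).trans ((Finset.sum_le_sum fun T _ => key T).trans ?_)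
  rw [Finset.sum_comm, mul_assoc, ← nsmul_eq_mul]
  refine Finset.sum_le_card_nsmul _ _ _ fun i _ => ?_
  rw [← Finset.sum_filter, ← Finset.sum_mul]
  exact mul_le_mul_of_nonneg_right (hW i) (nsq_nonneg φ)

/-- Removing weak creation terms preserves metastability on regions that are small compared with the
inverse strength of these terms. -/
lemma isMetastable_stabilizedHamiltonian (hG : G.Connected) {H : LocalHamiltonian G q}
    {Δ R R' w : ℝ} (hm : IsMetastable G H.op ketZero Δ R) (hR' : 1 ≤ R') (hRR' : R' ≤ R)
    (hw : ∀ i, ∑ S : Finset V with i ∈ S, ‖(creationHamiltonian hG H).term S‖ ≤ w)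
    (hcard : ∀ S : Finset V, IsConn G S → (diam G S : ℝ) ≤ R' → S.card * w ≤ Δ / 2) :
    IsMetastable G (stabilizedHamiltonian hG H).op ketZero (Δ / 2) R' := by
  refine isMetastable_of_le_qform hR' fun S hS hd φ hφ h0 => ?_
  have h1 := hm.le_qform hS (hd.trans hRR') hφ h0
  have h2 := (abs_le.1 (abs_qform_op_le (creationHamiltonian_term_zero_zero hG H) hw hφ)).2
  have h3 := mul_le_mul_of_nonneg_right (hcard S hS hd) (nsq_nonneg φ)
  rw [stabilizedHamiltonian_zero_zero]
  have h4 : qform H.op φ = qform (stabilizedHamiltonian hG H).op φ +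
      qform (creationHamiltonian hG H).op φ := by
    rw [← qform_add, ← op_eq_stabilized_add_creation hG H]
  linarith

end Decomposition

/-! ### Summation over the diameters -/

section Summation

lemma summable_pow_mul_exp_neg (n : ℕ) {c : ℝ} (hc : 0 < c) :
    Summable fun r : ℕ => (4 * r + 2 : ℝ) ^ n * Real.exp (-(c * r)) := by
  have h1 := ((summable_nat_add_iff 1).2 (Real.summable_pow_mul_exp_neg_nat_mul n hc)).mul_left
    (4 ^ n * Real.exp c)
  refine Summable.of_nonneg_of_le (fun r => by positivity) (fun r => ?_) h1
  have h2 : (4 * r + 2 : ℝ) ^ n ≤ 4 ^ n * (r + 1) ^ n := by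
    rw [← mul_pow]
    gcongr
    linarith
  have h3 : Real.exp (-(c * r)) = Real.exp c * Real.exp (-c * ((r + 1 : ℕ) : ℝ)) := by
    rw [← Real.exp_add]
    congr 1
    push_cast; ring
  rw [h3]
  calc _ ≤ 4 ^ n * (r + 1 : ℝ) ^ n * (Real.exp c * Real.exp (-c * ((r + 1 : ℕ) : ℝ))) := by gcongr
    _ = _ := by push_cast; ring

/-- Powers with exponent less than one are dominated by linear functions of any slope. -/
lemma exists_rpow_le_mul_add {α ε : ℝ} (hα : α ∈ Set.Ioo (0 : ℝ) 1) (hε : 0 < ε) :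
    ∃ A : ℝ, ∀ x : ℝ, 0 ≤ x → x ^ α ≤ ε * x + A := by
  obtain ⟨h0, h1⟩ := hα
  have h2 : 0 < 1 - α := by linarith
  set y : ℝ := ε ^ (-α / (1 - α)) with hy
  have hy0 : 0 < y := Real.rpow_pos_of_pos hε _
  refine ⟨y, fun x hx => ?_⟩
  have h3 := Real.geom_mean_le_arith_mean2_weighted h0.le h2.le (mul_nonneg hε.le hx) hy0.le
    (by ring)
  have h4 : (ε * x) ^ α * y ^ (1 - α) = x ^ α := by
    rw [Real.mul_rpow hε.le hx, hy, ← Real.rpow_mul hε.le, div_mul_cancel₀ _ h2.ne', mul_right_comm,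
      ← Real.rpow_add hε]
    simp
  have := mul_nonneg hε.le hx
  nlinarith

/-- The sum over the diameters in the bound for the strength of the creation terms converges, since
the weight grows only as a stretched exponential. -/
lemma exists_sum_stretched_exp_le (n : ℕ) {μ c α : ℝ} (hμ : 0 < μ) (hc : 0 < c)
    (hα : α ∈ Set.Ioo (0 : ℝ) 1) : ∃ C : ℝ, 0 < C ∧ ∀ D : ℕ, ∑ r ∈ range D,
      (4 * r + 2 : ℝ) ^ n * (Real.exp (μ * ((2 * r : ℕ) : ℝ) ^ α) * Real.exp (-(2 * c * r))) ≤
        C := by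
  obtain ⟨A, hA⟩ := exists_rpow_le_mul_add hα (ε := c / (2 * μ)) (by positivity)
  have hs := (summable_pow_mul_exp_neg n hc).mul_left (Real.exp (μ * A))
  refine ⟨∑' r : ℕ, Real.exp (μ * A) * ((4 * r + 2 : ℝ) ^ n * Real.exp (-(c * r))),
    hs.tsum_pos (fun r => by positivity) 0 (by positivity), fun D => ?_⟩
  refine (Finset.sum_le_sum fun r _ => ?_).trans (hs.sum_le_tsum _ fun r _ => by positivity)
  have h1 := hA ((2 * r : ℕ) : ℝ) (Nat.cast_nonneg _)
  have h2 : μ * ((2 * r : ℕ) : ℝ) ^ α ≤ c * r + μ * A := by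
    calc μ * ((2 * r : ℕ) : ℝ) ^ α ≤ μ * (c / (2 * μ) * ((2 * r : ℕ) : ℝ) + A) := by gcongr
      _ = _ := by push_cast; field_simp
  rw [mul_left_comm (Real.exp (μ * A)), ← Real.exp_add, ← Real.exp_add]
  refine mul_le_mul_of_nonneg_left (Real.exp_le_exp.2 ?_) (by positivity)
  linarith

lemma exists_sum_pow_mul_exp_le (n : ℕ) {c : ℝ} (hc : 0 < c) : ∃ C : ℝ, 0 < C ∧ ∀ D : ℕ,
    ∑ r ∈ range D, (4 * r + 2 : ℝ) ^ n * Real.exp (-(c * r)) ≤ C :=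
  ⟨_, (summable_pow_mul_exp_neg n hc).tsum_pos (fun r => by positivity) 0 (by positivity),
    fun _ => (summable_pow_mul_exp_neg n hc).sum_le_tsum _ fun r _ => by positivity⟩

lemma le_rpow_mul_rpow {a s t θ : ℝ} (ha : 0 ≤ a) (hs : a ≤ s) (ht : a ≤ t)
    (hθ : θ ∈ Set.Ioo (0 : ℝ) 1) : a ≤ s ^ θ * t ^ (1 - θ) := by
  have h1 : 0 < 1 - θ := by linarith [hθ.2]
  calc a = a ^ θ * a ^ (1 - θ) := by
        rw [← Real.rpow_add' ha (by simp)]; simp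
    _ ≤ s ^ θ * t ^ (1 - θ) := by
        have := hθ.1
        have := ha.trans hs
        gcongr

end Summation

/-! ### The strength of the creation terms on the torus -/

section Strength

variable {d : ℕ} {L : Fin d → ℕ} [∀ k, NeZero (L k)] {q : ℕ} [NeZero q]

lemma sum_norm_term_le_of_exp {V : Type} [Fintype V] [DecidableEq V] {G : SimpleGraph V}
    {H : LocalHamiltonian G q} {g : Finset V → ℝ} {h : ℝ} (hg : ∀ S, 0 ≤ g S) {i : V}
    (hH : ∑ S : Finset V with i ∈ S, Real.exp (g S) * ‖H.term S‖ ≤ h) :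
    ∑ S : Finset V with i ∈ S, ‖H.term S‖ ≤ h := by
  refine (Finset.sum_le_sum fun S _ => ?_).trans hH
  exact le_mul_of_one_le_left (norm_nonneg _) (Real.one_le_exp (hg S))

/-- The parts of `H|0⟩` have norm of order `R ^ (-d / 2)`: excitations of large diameter are created
by long-range terms only, and for the others the volume of the metastable region counts. -/
lemma sqrt_nsq_anchoredPart_le_rpow (hd : 1 ≤ d) {H : LocalHamiltonian (torusGraph L) q}
    {κ h Δ R : ℝ} (hκ : 0 ≤ κ)
    (hH : ∀ i, ∑ S : Finset (Torus L) with i ∈ S,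
      Real.exp (κ * diam (torusGraph L) S) * ‖H.term S‖ ≤ h)
    (hΔ : 0 ≤ Δ) (h0 : 0 < h) (hT : IsTranslationInvariant H)
    (hm : IsMetastable (torusGraph L) H.op ketZero Δ R) (hRL : ∀ k, R ≤ d * (L k : ℝ))
    (x : Torus L) (r : ℕ) :
    √(nsq (anchoredPart H x r)) ≤
      4 * (4 * d) ^ d * (4 * r + 2) ^ d * h * R ^ (-(d / 2 : ℝ)) := by
  have hR1 : 1 ≤ R := hm.1
  have hd1 : (1 : ℝ) ≤ d := by exact_mod_cast hd
  set m : ℕ := ⌊R / (4 * d)⌋₊ with hmdef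
  have hm1 : (m : ℝ) ≤ R / (4 * d) := Nat.floor_le (by positivity)
  have hm2 : R / (4 * d) < m + 1 := Nat.lt_floor_add_one _
  have hRhalf : R ^ (-(d / 2 : ℝ)) * R ^ (-(d / 2 : ℝ)) * R ^ d = 1 := by
    rw [← Real.rpow_natCast R d, ← Real.rpow_add (by positivity), ← Real.rpow_add (by positivity)]
    ring_nf
    simp
  by_cases hrm : 2 * (2 * r + 1) ≤ m + 1
  · have hmd : d * (m : ℝ) ≤ R / 4 := by
      calc d * (m : ℝ) ≤ d * (R / (4 * d)) := by gcongr
        _ = R / 4 := by field_simp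
    have hbox := creationWeight_le_of_box hd
      (fun i => sum_norm_term_le_of_exp (fun S => by positivity) (hH i)) hΔ h0 hT hm
      (r := r) (m := m) (n := ⌊R / 2⌋₊) ?_ ?_ ?_ hrm x
    · refine (sqrt_nsq_anchoredPart_le H x r).trans (Real.sqrt_le_left (by positivity) |>.2 ?_)
      have hF : 0 ≤ creationWeight H r x := Finset.sum_nonneg fun _ _ => by positivity
      have h1 : R ^ d ≤ (4 * d) ^ d * (m + 1 : ℝ) ^ d := by
        rw [← mul_pow]
        gcongr
        rw [div_lt_iff₀ (by positivity)] at hm2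
        linarith
      have h2 : R ^ d * creationWeight H r x ≤ (4 * d) ^ d *
          (16 * (4 * r + 1) ^ (2 * d) * h ^ 2) := by
        calc _ ≤ (4 * d) ^ d * (m + 1 : ℝ) ^ d * creationWeight H r x := by gcongr
          _ = (4 * d) ^ d * ((m + 1 : ℝ) ^ d * creationWeight H r x) := by ring
          _ ≤ _ := by gcongr
      have h3 : (4 * d : ℝ) ^ d ≤ (4 * d) ^ (2 * d) :=
        pow_le_pow_right₀ (by linarith) (by omega)
      have h4 : (4 * r + 1 : ℝ) ^ (2 * d) ≤ (4 * r + 2) ^ (2 * d) := by gcongr; norm_num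
      calc creationWeight H r x
          = R ^ (-(d / 2 : ℝ)) * R ^ (-(d / 2 : ℝ)) * (R ^ d * creationWeight H r x) := by
            rw [← mul_assoc, hRhalf, one_mul]
        _ ≤ R ^ (-(d / 2 : ℝ)) * R ^ (-(d / 2 : ℝ)) *
              ((4 * d) ^ (2 * d) * (16 * (4 * r + 2) ^ (2 * d) * h ^ 2)) := by
            exact mul_le_mul_of_nonneg_left (h2.trans (by gcongr)) (by positivity)
        _ = _ := by rw [pow_mul', pow_mul']; ring
    · have := Nat.floor_le (show 0 ≤ R / 2 by positivity)
      linarith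
    · refine Nat.le_floor ?_
      push_cast
      have h5 : (2 * (2 * r + 1) : ℝ) ≤ m + 1 := by exact_mod_cast hrm
      have h6 : (m : ℝ) ≤ d * m := le_mul_of_one_le_left (Nat.cast_nonneg _) hd1
      have : (0 : ℝ) ≤ r := Nat.cast_nonneg _
      linarith
    · intro k
      have hL : (0 : ℝ) < L k := by exact_mod_cast Nat.pos_of_ne_zero (NeZero.ne (L k))
      have : (m : ℝ) < L k := by
        refine hm1.trans_lt ?_
        rw [div_lt_iff₀ (by positivity)]
        nlinarith [hRL k]
      exact_mod_cast this
  · refine (sqrt_nsq_anchoredPart_le_exp hκ hH x r).trans ?_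
    have h1 : (m + 1 : ℝ) ≤ 4 * r + 2 := by
      have : m + 1 ≤ 4 * r + 2 := by omega
      exact_mod_cast this
    have h2 : R ≤ 4 * d * (4 * r + 2) := by
      have := hm2.le.trans h1
      rw [div_le_iff₀ (by positivity)] at this
      linarith
    have h3 : R ^ (d / 2 : ℝ) ≤ (4 * d) ^ d * (4 * r + 2) ^ d := by
      calc R ^ (d / 2 : ℝ) ≤ R ^ (d : ℝ) := Real.rpow_le_rpow_of_exponent_le hR1 (by linarith)
        _ = R ^ d := Real.rpow_natCast _ _
        _ ≤ (4 * d * (4 * r + 2)) ^ d := by gcongr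
        _ = _ := mul_pow _ _ _
    have h4 : R ^ (d / 2 : ℝ) * R ^ (-(d / 2 : ℝ)) = 1 := by
      rw [← Real.rpow_add (by positivity)]; simp
    have h5 : Real.exp (-(κ * r)) ≤ 1 := Real.exp_le_one_iff.2 (neg_nonpos.2 (by positivity))
    calc h * Real.exp (-(κ * r)) ≤ h * (R ^ (d / 2 : ℝ) * R ^ (-(d / 2 : ℝ))) := by
          rw [h4]; gcongr
      _ ≤ h * (4 * ((4 * d) ^ d * (4 * r + 2) ^ d) * R ^ (-(d / 2 : ℝ))) := by
          gcongr
          have : 0 ≤ (4 * d : ℝ) ^ d * (4 * r + 2) ^ d := by positivity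
          linarith
      _ = _ := by ring

lemma cast_card_gball_torus_le (x : Torus L) (r : ℕ) :
    ((gball (torusGraph L) x r).card : ℝ) ≤ (4 * r + 2) ^ d := by
  have h : (gball (torusGraph L) x r).card ≤ (4 * r + 2) ^ d :=
    (card_gball_torus_le x r).trans (Nat.pow_le_pow_left (by omega) d)
  exact_mod_cast h

/-- The volume factor is interpolated with the exponential decay in the diameter; a small power of
`R` pays for the sum over the diameters. -/
lemma exists_sum_exp_norm_creation_le {d : ℕ} (hd : 1 ≤ d) {μ α δ : ℝ} (hμ : 0 < μ)
    (hα : α ∈ Set.Ioo (0 : ℝ) 1) (hδ : δ ∈ Set.Ioo (0 : ℝ) 1) :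
    ∃ C : ℝ, 0 < C ∧ ∀ (q : ℕ) [NeZero q] (L : Fin d → ℕ) [∀ k, NeZero (L k)]
      (H : LocalHamiltonian (torusGraph L) q) (h Δ R : ℝ), 0 ≤ Δ → 0 < h →
      (∀ i, ∑ S : Finset (Torus L) with i ∈ S,
        Real.exp (2 * μ * diam (torusGraph L) S) * ‖H.term S‖ ≤ h) →
      IsTranslationInvariant H → IsMetastable (torusGraph L) H.op ketZero Δ R →
      (∀ k, R ≤ d * (L k : ℝ)) → ∀ i, ∑ S : Finset (Torus L) with i ∈ S,
        Real.exp (μ * (diam (torusGraph L) S : ℝ) ^ α) *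
          ‖(creationHamiltonian torusGraph_connected H).term S‖ ≤ C * h * R ^ ((δ - d) / 2) := by
  have hd1 : (1 : ℝ) ≤ d := by exact_mod_cast hd
  set θ : ℝ := δ / d with hθdef
  have hθ : θ ∈ Set.Ioo (0 : ℝ) 1 :=
    ⟨div_pos hδ.1 (by linarith), (div_lt_one (by linarith)).2 (hδ.2.trans_le hd1)⟩
  obtain ⟨C, hC, hsum⟩ := exists_sum_stretched_exp_le (d + d) hμ (mul_pos hμ hθ.1) hα
  set K : ℝ := 4 * (4 * d) ^ d with hK
  have hK1 : 1 ≤ K := by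
    have : (1 : ℝ) ≤ (4 * d) ^ d := one_le_pow₀ (by linarith)
    linarith
  refine ⟨2 * K * C, by positivity, ?_⟩
  intro q _ L _ H h Δ R hΔ h0 hH hT hm hRL i
  have hR1 : 1 ≤ R := hm.1
  have hb : ∀ x r, √(nsq (anchoredPart H x r)) ≤
      K * h * R ^ ((δ - d) / 2) * ((4 * r + 2) ^ d * Real.exp (-(2 * (μ * θ) * r))) := by
    intro x r
    refine (le_rpow_mul_rpow (Real.sqrt_nonneg _)
      (sqrt_nsq_anchoredPart_le_exp (by positivity) hH x r)
      (sqrt_nsq_anchoredPart_le_rpow hd (by positivity) hH hΔ h0 hT hm hRL x r) hθ).trans ?_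
    have hP1 : 1 ≤ K * (4 * r + 2 : ℝ) ^ d :=
      one_le_mul_of_one_le_of_one_le hK1 (one_le_pow₀ (by
        have : (0 : ℝ) ≤ r := Nat.cast_nonneg _
        linarith))
    rw [Real.mul_rpow h0.le (Real.exp_nonneg _), ← Real.exp_mul,
      Real.mul_rpow (by positivity) (by positivity), Real.mul_rpow (by positivity) h0.le,
      ← Real.rpow_mul (by positivity)]
    have e1 : -(d / 2 : ℝ) * (1 - θ) = (δ - d) / 2 := by rw [hθdef]; field_simp; ring
    have e2 : -(2 * μ * r) * θ = -(2 * (μ * θ) * r) := by ring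
    have e3 : h ^ θ * h ^ (1 - θ) = h := by rw [← Real.rpow_add h0]; simp
    have e4 : (K * (4 * r + 2 : ℝ) ^ d) ^ (1 - θ) ≤ K * (4 * r + 2 : ℝ) ^ d := by
      conv_rhs => rw [← Real.rpow_one (K * (4 * r + 2 : ℝ) ^ d)]
      exact Real.rpow_le_rpow_of_exponent_le hP1 (by linarith [hθ.1])
    rw [e1, e2]
    calc _ = h ^ θ * h ^ (1 - θ) * R ^ ((δ - d) / 2) * Real.exp (-(2 * (μ * θ) * r)) *
          (K * (4 * r + 2 : ℝ) ^ d) ^ (1 - θ) := by ring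
      _ ≤ h * R ^ ((δ - d) / 2) * Real.exp (-(2 * (μ * θ) * r)) * (K * (4 * r + 2 : ℝ) ^ d) := by
          rw [e3]; gcongr
      _ = _ := by ring
  have hα0 := hα.1
  refine (sum_norm_creation_le torusGraph_connected H hb cast_card_gball_torus_le
    (g := fun n => Real.exp (μ * (n : ℝ) ^ α)) (fun _ => Real.exp_nonneg _)
    (fun a b hab => Real.exp_le_exp.2 (by gcongr)) i).trans ?_
  calc _ = 2 * K * h * R ^ ((δ - d) / 2) * ∑ r ∈ range (diam (torusGraph L) univ + 1),
        (4 * r + 2 : ℝ) ^ (d + d) *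
          (Real.exp (μ * ((2 * r : ℕ) : ℝ) ^ α) * Real.exp (-(2 * (μ * θ) * r))) := by
        rw [Finset.mul_sum]
        refine Finset.sum_congr rfl fun r _ => ?_
        rw [pow_add]; ring
    _ ≤ 2 * K * h * R ^ ((δ - d) / 2) * C := by
        gcongr
        exact hsum _
    _ = _ := by ring

lemma exists_sum_exp_norm_creation_le_mul (d : ℕ) {μ : ℝ} (hμ : 0 < μ) :
    ∃ C : ℝ, 0 < C ∧ ∀ (q : ℕ) [NeZero q] (L : Fin d → ℕ) [∀ k, NeZero (L k)]
      (H : LocalHamiltonian (torusGraph L) q) (h : ℝ), 0 < h →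
      (∀ i, ∑ S : Finset (Torus L) with i ∈ S,
        Real.exp (2 * μ * diam (torusGraph L) S) * ‖H.term S‖ ≤ h) →
      ∀ i, ∑ S : Finset (Torus L) with i ∈ S,
        Real.exp (2 / 5 * μ * diam (torusGraph L) S) *
          ‖(creationHamiltonian torusGraph_connected H).term S‖ ≤ C * h := by
  obtain ⟨C, hC, hsum⟩ := exists_sum_pow_mul_exp_le d (c := 6 / 5 * μ) (by positivity)
  refine ⟨2 * C, by positivity, ?_⟩
  intro q _ L _ H h h0 hH i
  refine (sum_norm_creation_le torusGraph_connected H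
    (sqrt_nsq_anchoredPart_le_exp (by positivity) hH) cast_card_gball_torus_le
    (g := fun n => Real.exp (2 / 5 * μ * n)) (fun _ => Real.exp_nonneg _)
    (fun a b hab => Real.exp_le_exp.2 (by gcongr)) i).trans ?_
  calc _ = 2 * h * ∑ r ∈ range (diam (torusGraph L) univ + 1),
        (4 * r + 2 : ℝ) ^ d * Real.exp (-(6 / 5 * μ * r)) := by
        rw [Finset.mul_sum]
        refine Finset.sum_congr rfl fun r _ => ?_
        have : Real.exp (-(6 / 5 * μ * r)) =
            Real.exp (2 / 5 * μ * ((2 * r : ℕ) : ℝ)) * Real.exp (-(2 * μ * r)) := by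
          rw [← Real.exp_add]
          congr 1
          push_cast; ring
        rw [this]; ring
    _ ≤ 2 * h * C := by
        gcongr
        exact hsum _
    _ = _ := by ring

lemma card_le_of_diam_le {S : Finset (Torus L)} {R : ℝ} (hR : 1 ≤ R)
    (hS : (diam (torusGraph L) S : ℝ) ≤ R) : (S.card : ℝ) ≤ (3 * R) ^ d := by
  rcases S.eq_empty_or_nonempty with rfl | ⟨x, hx⟩
  · simp; positivity
  calc (S.card : ℝ) ≤ (2 * diam (torusGraph L) S + 1 : ℝ) ^ d := by
        exact_mod_cast (Finset.card_le_card (subset_gball_diam hx)).trans (card_gball_torus_le x _)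
    _ ≤ _ := by gcongr; linarith

end Strength

/-! ### Splitting the Hamiltonian -/

section LocalNorm

variable {V : Type} [Fintype V] [DecidableEq V] {G : SimpleGraph V} {q : ℕ}

lemma sum_le_localNorm (H : LocalHamiltonian G q) (κ α : ℝ) (i : V) :
    ∑ S : Finset V with i ∈ S, Real.exp (κ * (diam G S : ℝ) ^ α) * ‖H.term S‖ ≤
      H.localNorm κ α :=
  le_ciSup (f := fun i : V => ∑ S : Finset V with i ∈ S,
    Real.exp (κ * (diam G S : ℝ) ^ α) * ‖H.term S‖) (Set.finite_range _).bddAbove i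

end LocalNorm

end ManyBody

end

theorem mainTheorem2 (d : ℕ) (hd : 1 ≤ d) (μ ρ : ℝ) (hμ : 0 < μ) (hρ : 0 < ρ) :
    ∃ cR : ℝ, 0 < cR ∧ ∀ α ∈ Set.Ioo (0 : ℝ) 1, ∀ δ ∈ Set.Ioo (0 : ℝ) 1,
      ∃ cH cδ cδ' : ℝ, 0 < cH ∧ 0 < cδ ∧ 0 < cδ' ∧
        ∀ (q : ℕ) [NeZero q] (L : Fin d → ℕ) [∀ k, NeZero (L k)]
          (H : ManyBody.LocalHamiltonian (ManyBody.torusGraph L) q) (h Δ R : ℝ),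
          0 < Δ → h / Δ = ρ →
          H.localNorm (2 * μ) 1 ≤ h →
          ManyBody.IsTranslationInvariant H →
          ManyBody.IsMetastable (ManyBody.torusGraph L) H.op ManyBody.ketZero Δ R →
          cR ≤ R → (∀ k, R ≤ d * (L k : ℝ)) →
          ∃ H₀ W : ManyBody.LocalHamiltonian (ManyBody.torusGraph L) q,
            H.op = H₀.op + W.op ∧
            (∃ E₀ : ℝ, H₀.op.mulVec ManyBody.ketZero = (E₀ : ℂ) • ManyBody.ketZero) ∧
            ManyBody.IsMetastable (ManyBody.torusGraph L) H₀.op ManyBody.ketZero (Δ / 2)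
              (max 1 (cδ' * R ^ (1 / 2 - δ / d))) ∧
            H₀.localNorm (2 / 5 * μ) 1 ≤ cH * h ∧
            W.localNorm μ α ≤ cδ * h * R ^ (δ - d / 2) := by
  open ManyBody in
  have hd1 : (1 : ℝ) ≤ d := by exact_mod_cast hd
  -- the requirement on `R` must not depend on `α` and `δ`, so it is derived from fixed values
  obtain ⟨C₀, hC₀, hbound₀⟩ := exists_sum_exp_norm_creation_le hd (α := 1 / 2) (δ := 1 / 2) hμ
    (by norm_num) (by norm_num)
  obtain ⟨C₁, hC₁, hbound₁⟩ := exists_sum_exp_norm_creation_le_mul d hμ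
  refine ⟨max 1 ((2 * 3 ^ d * C₀ * ρ) ^ 4), by positivity, fun α hα δ hδ => ?_⟩
  obtain ⟨C, hC, hbound⟩ := exists_sum_exp_norm_creation_le hd hμ hα hδ
  set c : ℝ := min 1 (1 / (2 * 3 ^ d * C * ρ)) with hcdef
  have hc0 : 0 < c := by positivity
  have hc1 : c ≤ 1 := min_le_left _ _
  refine ⟨1 + C₁, C, c, by positivity, hC, hc0, ?_⟩
  intro q _ L _ H h Δ R hΔ hh hH hT hm hcR hRL
  have hR1 : 1 ≤ R := hm.1
  have hhρ : h = ρ * Δ := (div_eq_iff hΔ.ne').1 hh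
  have h0 : 0 < h := hhρ ▸ mul_pos hρ hΔ
  have hG := torusGraph_connected (L := L)
  have hHi : ∀ i, ∑ S : Finset (Torus L) with i ∈ S,
      Real.exp (2 * μ * diam (torusGraph L) S) * ‖H.term S‖ ≤ h := fun i => by
    have := (sum_le_localNorm H (2 * μ) 1 i).trans hH
    simpa only [Real.rpow_one] using this
  have hb₀ := hbound₀ q L H h Δ R hΔ.le h0 hHi hT hm hRL
  have hb := hbound q L H h Δ R hΔ.le h0 hHi hT hm hRL
  have hw₀ := fun i => sum_norm_term_le_of_exp
    (fun S => mul_nonneg hμ.le (Real.rpow_nonneg (Nat.cast_nonneg _) _)) (hb₀ i)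
  have hw := fun i => sum_norm_term_le_of_exp
    (fun S => mul_nonneg hμ.le (Real.rpow_nonneg (Nat.cast_nonneg _) _)) (hb i)
  refine ⟨stabilizedHamiltonian hG H, creationHamiltonian hG H,
    op_eq_stabilized_add_creation hG H, ⟨_, stabilizedHamiltonian_mulVec_ketZero hG H⟩, ?_, ?_, ?_⟩
  · have hcR4 : 2 * 3 ^ d * C₀ * ρ ≤ R ^ (1 / 4 : ℝ) := by
      have h1 := (le_max_right _ _).trans hcR
      calc 2 * 3 ^ d * C₀ * ρ = ((2 * 3 ^ d * C₀ * ρ) ^ 4) ^ (1 / 4 : ℝ) := by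
            have := Real.pow_rpow_inv_natCast (x := 2 * 3 ^ d * C₀ * ρ) (n := 4) (by positivity)
              (by norm_num)
            rw [one_div]
            exact_mod_cast this.symm
        _ ≤ R ^ (1 / 4 : ℝ) := by gcongr
    rcases le_total (c * R ^ (1 / 2 - δ / d)) 1 with hle | hle
    · rw [max_eq_left hle]
      refine isMetastable_stabilizedHamiltonian hG hm le_rfl hR1 hw₀ fun S _ hS => ?_
      have h1 : R ^ ((1 / 2 - d) / 2 : ℝ) ≤ R ^ (-(1 / 4) : ℝ) :=
        Real.rpow_le_rpow_of_exponent_le hR1 (by linarith)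
      have h2 : R ^ (1 / 4 : ℝ) * R ^ (-(1 / 4) : ℝ) = 1 := by
        rw [← Real.rpow_add (by positivity)]; simp
      have h3 : (0 : ℝ) ≤ R ^ (-(1 / 4) : ℝ) := by positivity
      calc S.card * (C₀ * h * R ^ ((1 / 2 - d) / 2 : ℝ))
          ≤ (3 * 1) ^ d * (C₀ * h * R ^ (-(1 / 4) : ℝ)) := by
            gcongr
            exact card_le_of_diam_le le_rfl hS
        _ = 2 * 3 ^ d * C₀ * ρ * R ^ (-(1 / 4) : ℝ) * (Δ / 2) := by rw [hhρ]; ring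
        _ ≤ R ^ (1 / 4 : ℝ) * R ^ (-(1 / 4) : ℝ) * (Δ / 2) := by gcongr
        _ = Δ / 2 := by rw [h2, one_mul]
    · rw [max_eq_right hle]
      have hle' : c * R ^ (1 / 2 - δ / d) ≤ R := by
        calc c * R ^ (1 / 2 - δ / d) ≤ 1 * R ^ (1 : ℝ) := by
              have : 0 < δ / d := div_pos hδ.1 (by linarith)
              gcongr
              linarith
          _ = R := by simp
      refine isMetastable_stabilizedHamiltonian hG hm hle hle' hw fun S _ hS => ?_
      have hcd : c ^ d ≤ 1 / (2 * 3 ^ d * C * ρ) :=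
        (pow_le_of_le_one hc0.le hc1 (by omega)).trans (min_le_right _ _)
      -- the volume of the region is at most of order `R ^ (d / 2 - δ)`
      have hpow : (R ^ (1 / 2 - δ / d)) ^ d * R ^ ((δ - d) / 2) ≤ 1 := by
        rw [← Real.rpow_natCast, ← Real.rpow_mul (by positivity), ← Real.rpow_add (by positivity)]
        refine Real.rpow_le_one_of_one_le_of_nonpos hR1 ?_
        have : (1 / 2 - δ / d) * d = d / 2 - δ := by field_simp
        rw [this]
        linarith [hδ.1]
      calc S.card * (C * h * R ^ ((δ - d) / 2))
          ≤ (3 * (c * R ^ (1 / 2 - δ / d))) ^ d * (C * h * R ^ ((δ - d) / 2)) := by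
            gcongr
            exact card_le_of_diam_le hle hS
        _ = 3 ^ d * C * ρ * Δ * (c ^ d * ((R ^ (1 / 2 - δ / d)) ^ d * R ^ ((δ - d) / 2))) := by
            rw [hhρ, mul_pow, mul_pow]; ring
        _ ≤ 3 ^ d * C * ρ * Δ * (1 / (2 * 3 ^ d * C * ρ) * 1) := by gcongr
        _ = Δ / 2 := by field_simp
  · refine ciSup_le fun i => ?_
    simp only [Real.rpow_one]
    have h1 : ∑ S : Finset (Torus L) with i ∈ S,
        Real.exp (2 / 5 * μ * diam (torusGraph L) S) * ‖H.term S‖ ≤ h := by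
      refine (Finset.sum_le_sum fun S _ => ?_).trans (hHi i)
      gcongr
      linarith
    have h2 := hbound₁ q L H h h0 hHi i
    rw [add_mul, one_mul]
    refine le_trans ?_ (add_le_add h1 h2)
    rw [← Finset.sum_add_distrib]
    refine Finset.sum_le_sum fun S _ => ?_
    rw [← mul_add]
    gcongr
    exact norm_sub_le _ _
  · refine ciSup_le fun i => (hb i).trans ?_
    gcongr
    linarith [hδ.1]
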